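/- Let $A$ be a unital $C^*$-algebra and let $\alpha\colon\mathbb{T}\to\mathrm{Aut}(A)$ be a continuous action of the circle with the Rokhlin property: for every $\varepsilon>0$ and every finite set $F\subseteq A$ there is a unitary $u\in A$ with $\|\alpha_\zeta(u)-\zeta u\|<\varepsilon$ for all $\zeta\in\mathbb{T}$ and $\|ua-au\|<\varepsilon$ for all $a\in F$. Write $A^\alpha$ for the fixed point algebra, $A\rtimes_\alpha\mathbb{T}$ for the crossed product, and $\mathcal{K}(L^2(\mathbb{T}))$ for the compact operators on $L^2(\mathbb{T})$. Then there exists a unitary $u\in A$ with $\alpha_\zeta(u)=\zeta u$ for all $\zeta\in\mathbb{T}$ (equivalently, a presentation of $\alpha$ as the dual action on the crossed product of $A^\alpha$ by the automorphism $\mathrm{Ad}(u)|_{A^\alpha}$), and there are $*$-isomorphisms $$\Psi_{A,\alpha,u}\colon A\rtimes_\alpha\mathbb{T}\;\longrightarrow\; A^\alpha\otimes\mathcal{K}(L^2(\mathbb{T})),$$ one for each such triple $(A,\alpha,u)$ ($\alpha$ with the Rokhlin property, $u\in A$ a unitary with $\alpha_\zeta(u)=\zeta u$ for all $\zeta$),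 which are natural in the following sense: if $(A,\alpha,u)$ and $(B,\beta,v)$ are two such triples and $\varphi\colon A\to B$ is a unital $*$-homomorphism with $\varphi\circ\alpha_\zeta=\beta_\zeta\circ\varphi$ for all $\zeta\in\mathbb{T}$ and $\varphi(u)=v$, then $$\Psi_{B,\beta,v}\circ(\varphi\rtimes\mathbb{T})=\bigl(\varphi|_{A^\alpha}\otimes\mathrm{id}_{\mathcal{K}(L^2(\mathbb{T}))}\bigr)\circ\Psi_{A,\alpha,u}.$$ -/

import Mathlib

open MeasureTheory UniformSpace TensorProduct

set_option linter.unusedSectionVars false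

noncomputable section

namespace CircleRokhlin

/-! ### Enveloping C*-algebras of *-algebras -/

section Envelope

variable {X Y Z : Type*}
  [NonUnitalRing X] [StarRing X] [Module ℂ X] [IsScalarTower ℂ X X] [SMulCommClass ℂ X X]
  [StarModule ℂ X]
  [NonUnitalRing Y] [StarRing Y] [Module ℂ Y] [IsScalarTower ℂ Y Y] [SMulCommClass ℂ Y Y]
  [StarModule ℂ Y]

/-- A C*-seminorm on a complex *-algebra. -/
structure IsCStarSeminorm (p : Seminorm ℂ X) : Prop where
  map_mul_le : ∀ x y, p (x * y) ≤ p x * p y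
  map_star_mul_self : ∀ x, p (star x * x) = p x ^ 2

theorem IsCStarSeminorm.map_star {p : Seminorm ℂ X} (hp : IsCStarSeminorm p) (x : X) :
    p (star x) = p x := by
  have key : ∀ y, p y ≤ p (star y) := by
    intro y
    have h1 := hp.map_star_mul_self y
    have h2 := hp.map_mul_le (star y) y
    by_contra hlt
    have h3 : 0 ≤ p (star y) := apply_nonneg p _
    have h4 : p (star y) < p y := not_le.mp hlt
    nlinarith
  refine le_antisymm ?_ (key x)
  simpa using key (star x)

/-- The greatest C*-seminorm which is dominated by the function `b`. -/
def maxCStarSeminorm (b : X → ℝ) : Seminorm ℂ X :=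
  sSup {p | IsCStarSeminorm p ∧ ∀ x, p x ≤ b x}

theorem maxCStarSeminorm_apply (b : X → ℝ) (x : X) :
    maxCStarSeminorm b x =
      ⨆ p : {p : Seminorm ℂ X | IsCStarSeminorm p ∧ ∀ x, p x ≤ b x}, (p : Seminorm ℂ X) x := by
  refine Seminorm.sSup_apply (Seminorm.bddAbove_iff.mpr ⟨b, ?_⟩)
  rintro _ ⟨p, hp, rfl⟩ x
  exact hp.2 x

theorem bddAbove_range_cstarSeminorm (b : X → ℝ) (x : X) :
    BddAbove (Set.range fun p : {p : Seminorm ℂ X | IsCStarSeminorm p ∧ ∀ x, p x ≤ b x} =>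
      (p : Seminorm ℂ X) x) := by
  refine ⟨b x, ?_⟩
  rintro _ ⟨p, rfl⟩
  exact p.2.2 x

theorem le_maxCStarSeminorm {b : X → ℝ} {p : Seminorm ℂ X} (hp : IsCStarSeminorm p)
    (hb : ∀ x, p x ≤ b x) (x : X) : p x ≤ maxCStarSeminorm b x := by
  rw [maxCStarSeminorm_apply]
  exact le_ciSup (bddAbove_range_cstarSeminorm b x) ⟨p, hp, hb⟩

theorem maxCStarSeminorm_le {b : X → ℝ} {x : X} {r : ℝ} (hr : 0 ≤ r)
    (h : ∀ p : Seminorm ℂ X, IsCStarSeminorm p → (∀ y, p y ≤ b y) → p x ≤ r) :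
    maxCStarSeminorm b x ≤ r := by
  rw [maxCStarSeminorm_apply]
  exact Real.iSup_le (fun p => h p.1 p.2.1 p.2.2) hr

theorem isCStarSeminorm_max (b : X → ℝ) : IsCStarSeminorm (maxCStarSeminorm b) where
  map_mul_le x y := by
    have h1 : 0 ≤ maxCStarSeminorm b x := apply_nonneg _ _
    have h2 : 0 ≤ maxCStarSeminorm b y := apply_nonneg _ _
    refine maxCStarSeminorm_le (mul_nonneg h1 h2) fun p hp hb => ?_
    exact (hp.map_mul_le x y).trans (mul_le_mul (le_maxCStarSeminorm hp hb x)
      (le_maxCStarSeminorm hp hb y) (apply_nonneg _ _) h1)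
  map_star_mul_self x := by
    refine le_antisymm ?_ ?_
    · refine maxCStarSeminorm_le (sq_nonneg _) fun p hp hb => ?_
      rw [hp.map_star_mul_self]
      exact pow_le_pow_left₀ (apply_nonneg _ _) (le_maxCStarSeminorm hp hb x) 2
    · have h0 : 0 ≤ maxCStarSeminorm b (star x * x) := apply_nonneg _ _
      have : maxCStarSeminorm b x ≤ Real.sqrt (maxCStarSeminorm b (star x * x)) := by
        refine maxCStarSeminorm_le (Real.sqrt_nonneg _) fun p hp hb => ?_
        refine Real.le_sqrt_of_sq_le ?_
        rw [← hp.map_star_mul_self]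
        exact le_maxCStarSeminorm hp hb _
      calc maxCStarSeminorm b x ^ 2
          ≤ Real.sqrt (maxCStarSeminorm b (star x * x)) ^ 2 :=
            pow_le_pow_left₀ (apply_nonneg _ _) this 2
        _ = _ := Real.sq_sqrt h0

/-- A *-algebra as a seminormed ring, with the greatest C*-seminorm dominated by `b`. -/
abbrev envelopeRing (b : X → ℝ) : NonUnitalSeminormedRing X :=
  { (inferInstance : NonUnitalRing X) with
    norm := maxCStarSeminorm b
    dist := fun x y => maxCStarSeminorm b (-x + y)
    dist_self := fun x => by rw [neg_add_cancel, map_zero]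
    dist_comm := fun x y => by rw [← map_neg_eq_map, neg_add, neg_neg, add_comm]
    dist_triangle := fun x y z => by
      refine le_trans (le_of_eq ?_) (map_add_le_add (maxCStarSeminorm b) _ _)
      congr 1
      abel
    dist_eq := fun _ _ => rfl
    norm_mul_le := (isCStarSeminorm_max b).map_mul_le }

/-- The scalar multiplication is compatible with the greatest C*-seminorm. -/
abbrev envelopeSpace (b : X → ℝ) :
    @NormedSpace ℂ X _ (envelopeRing b).toSeminormedAddCommGroup :=
  letI := envelopeRing b
  { (inferInstance : Module ℂ X) with
    norm_smul_le := fun a x => (map_smul_eq_mul (maxCStarSeminorm b) a x).le }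

/-- The *-algebra `X`, seminormed by the greatest C*-seminorm dominated by `b`. -/
def PreEnvelope (_b : X → ℝ) : Type _ := X

variable (b : X → ℝ) (c : Y → ℝ)

instance : NonUnitalSeminormedRing (PreEnvelope b) := envelopeRing (X := X) b
instance : NormedSpace ℂ (PreEnvelope b) := envelopeSpace (X := X) b
instance : StarRing (PreEnvelope b) := ‹StarRing X›
instance : IsScalarTower ℂ (PreEnvelope b) (PreEnvelope b) := ‹IsScalarTower ℂ X X›
instance : SMulCommClass ℂ (PreEnvelope b) (PreEnvelope b) := ‹SMulCommClass ℂ X X›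
instance : StarModule ℂ (PreEnvelope b) := ‹StarModule ℂ X›
instance : NormedStarGroup (PreEnvelope b) where
  norm_star_le x := ((isCStarSeminorm_max b).map_star x).le

/-- The enveloping C*-algebra: the Hausdorff completion of the *-algebra `X` with respect to the
greatest C*-seminorm dominated by `b`. -/
def CStarEnvelope (b : X → ℝ) : Type _ := Completion (PreEnvelope b)

namespace CStarEnvelope

/-! The multiplication and the involution extend to the completion by continuity. -/

variable {b}

abbrev Cpl (b : X → ℝ) : Type _ := Completion (PreEnvelope b)

/-- Multiplication on the completion. -/
def cmul (z w : Cpl b) : Cpl b :=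
  (Completion.isDenseInducing_coe.prodMap
      (Completion.isDenseInducing_coe (α := PreEnvelope b))).extend
      ((fun x : PreEnvelope b => (x : Cpl b)) ∘
        Function.uncurry (· * · : PreEnvelope b → PreEnvelope b → PreEnvelope b)) (z, w)

/-- The involution on the completion. -/
def cstar (z : Cpl b) : Cpl b := Completion.map (star : PreEnvelope b → PreEnvelope b) z

theorem cmul_coe (x y : PreEnvelope b) : cmul (x : Cpl b) y = ((x * y : PreEnvelope b) : Cpl b) :=
  ((Completion.isDenseInducing_coe.prodMap
    (Completion.isDenseInducing_coe (α := PreEnvelope b))).extend_eq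
      ((Completion.continuous_coe (PreEnvelope b)).comp
        (continuous_mul (M := PreEnvelope b))) (x, y))

theorem continuous_cmul' : Continuous fun z : Cpl b × Cpl b => cmul z.1 z.2 := by
  let m := (AddMonoidHom.mul : PreEnvelope b →+ PreEnvelope b →+ PreEnvelope b).compr₂
    Completion.toCompl
  have h : Continuous fun p : PreEnvelope b × PreEnvelope b => m p.1 p.2 :=
    (Completion.continuous_coe _).comp continuous_mul
  have di : IsDenseInducing
      (Completion.toCompl : PreEnvelope b → Completion (PreEnvelope b)) :=
    Completion.isDenseInducing_coe
  exact (di.extend_Z_bilin di h :)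

@[fun_prop]
theorem continuous_cmul {T : Type*} [TopologicalSpace T] {f g : T → Cpl b} (hf : Continuous f)
    (hg : Continuous g) : Continuous fun t => cmul (f t) (g t) :=
  continuous_cmul'.comp (hf.prodMk hg)

theorem cstar_coe (x : PreEnvelope b) : cstar (x : Cpl b) = ((star x : PreEnvelope b) : Cpl b) :=
  Completion.map_coe
    (starₗᵢ ℂ : PreEnvelope b ≃ₗᵢ⋆[ℂ] PreEnvelope b).isometry.uniformContinuous x

@[fun_prop]
theorem continuous_cstar {T : Type*} [TopologicalSpace T] {f : T → Cpl b} (hf : Continuous f) :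
    Continuous fun t => cstar (f t) :=
  Completion.continuous_map.comp hf

theorem cmul_zero (z : Cpl b) : cmul z 0 = 0 := by
  refine Completion.induction_on z (isClosed_eq (by fun_prop) continuous_const) fun x => ?_
  rw [← Completion.coe_zero, cmul_coe, mul_zero]

theorem zero_cmul (z : Cpl b) : cmul 0 z = 0 := by
  refine Completion.induction_on z (isClosed_eq (by fun_prop) continuous_const) fun x => ?_
  rw [← Completion.coe_zero, cmul_coe, zero_mul]

theorem cmul_assoc (x y z : Cpl b) : cmul (cmul x y) z = cmul x (cmul y z) := by
  refine Completion.induction_on₃ x y z (isClosed_eq (by fun_prop) (by fun_prop)) fun x y z => ?_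
  simp only [cmul_coe, mul_assoc]

theorem cmul_add (x y z : Cpl b) : cmul x (y + z) = cmul x y + cmul x z := by
  refine Completion.induction_on₃ x y z (isClosed_eq (by fun_prop) (by fun_prop)) fun x y z => ?_
  simp only [cmul_coe, mul_add, ← Completion.coe_add]

theorem add_cmul (x y z : Cpl b) : cmul (x + y) z = cmul x z + cmul y z := by
  refine Completion.induction_on₃ x y z (isClosed_eq (by fun_prop) (by fun_prop)) fun x y z => ?_
  simp only [cmul_coe, add_mul, ← Completion.coe_add]

theorem smul_cmul (a : ℂ) (x y : Cpl b) : cmul (a • x) y = a • cmul x y := by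
  refine Completion.induction_on₂ x y (isClosed_eq
    (continuous_cmul ((continuous_fst).const_smul a) continuous_snd)
    ((continuous_cmul continuous_fst continuous_snd).const_smul a)) fun x y => ?_
  simp only [cmul_coe, ← Completion.coe_smul, smul_mul_assoc]

theorem cmul_smul (a : ℂ) (x y : Cpl b) : cmul x (a • y) = a • cmul x y := by
  refine Completion.induction_on₂ x y (isClosed_eq
    (continuous_cmul continuous_fst ((continuous_snd).const_smul a))
    ((continuous_cmul continuous_fst continuous_snd).const_smul a)) fun x y => ?_
  simp only [cmul_coe, ← Completion.coe_smul, mul_smul_comm]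

theorem cstar_cstar (x : Cpl b) : cstar (cstar x) = x := by
  refine Completion.induction_on x (isClosed_eq (by fun_prop) (by fun_prop)) fun x => ?_
  simp only [cstar_coe, star_star]

theorem cstar_cmul (x y : Cpl b) : cstar (cmul x y) = cmul (cstar y) (cstar x) := by
  refine Completion.induction_on₂ x y (isClosed_eq (by fun_prop) (by fun_prop)) fun x y => ?_
  simp only [cmul_coe, cstar_coe, star_mul]

theorem cstar_add (x y : Cpl b) : cstar (x + y) = cstar x + cstar y := by
  refine Completion.induction_on₂ x y (isClosed_eq (by fun_prop) (by fun_prop)) fun x y => ?_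
  simp only [← Completion.coe_add, cstar_coe, star_add]

theorem cstar_smul (a : ℂ) (x : Cpl b) : cstar (a • x) = star a • cstar x := by
  refine Completion.induction_on x (isClosed_eq
    (continuous_cstar (continuous_id.const_smul a))
    ((continuous_cstar continuous_id).const_smul (star a))) fun x => ?_
  simp only [← Completion.coe_smul, cstar_coe, star_smul]

theorem norm_cmul_le (x y : Cpl b) : ‖cmul x y‖ ≤ ‖x‖ * ‖y‖ := by
  refine Completion.induction_on₂ x y (isClosed_le (by fun_prop) (by fun_prop)) fun x y => ?_
  simp only [cmul_coe, Completion.norm_coe]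
  exact norm_mul_le x y

theorem norm_cstar_cmul_self (x : Cpl b) : ‖x‖ * ‖x‖ ≤ ‖cmul (cstar x) x‖ := by
  refine Completion.induction_on x (isClosed_le (by fun_prop) (by fun_prop)) fun x => ?_
  simp only [cmul_coe, cstar_coe, Completion.norm_coe]
  exact (sq (‖x‖)).symm.le.trans ((isCStarSeminorm_max b).map_star_mul_self x).symm.le

instance : NonUnitalCStarAlgebra (CStarEnvelope b) :=
  { (inferInstance : NormedAddCommGroup (Cpl b)),
    (inferInstance : NormedSpace ℂ (Cpl b)),
    (inferInstance : CompleteSpace (Cpl b)) with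
    mul := cmul (b := b)
    star := cstar (b := b)
    zero_mul := zero_cmul (b := b)
    mul_zero := cmul_zero (b := b)
    mul_assoc := cmul_assoc (b := b)
    left_distrib := cmul_add (b := b)
    right_distrib := add_cmul (b := b)
    norm_mul_le := norm_cmul_le (b := b)
    star_involutive := cstar_cstar (b := b)
    star_mul := cstar_cmul (b := b)
    star_add := cstar_add (b := b)
    norm_mul_self_le := norm_cstar_cmul_self (b := b)
    smul_assoc := smul_cmul (b := b)
    smul_comm := fun a x y => (cmul_smul (b := b) a x y).symm
    star_smul := cstar_smul (b := b) }

/-- The canonical map of `X` into its enveloping C*-algebra, as a linear map. -/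
def ofL (b : X → ℝ) : X →ₗ[ℂ] CStarEnvelope b :=
  (Completion.toComplL (𝕜 := ℂ) (E := PreEnvelope b)).toLinearMap

theorem norm_ofL (x : X) : ‖ofL b x‖ = maxCStarSeminorm b x :=
  Completion.norm_coe (E := PreEnvelope b) x

theorem denseRange_ofL : DenseRange (ofL b) :=
  Completion.denseRange_coe (α := PreEnvelope b)

theorem ofL_mul (x y : X) : ofL b (x * y) = ofL b x * ofL b y :=
  (cmul_coe (b := b) x y).symm

theorem ofL_star (x : X) : ofL b (star x) = star (ofL b x) :=
  (cstar_coe (b := b) x).symm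

@[elab_as_elim]
theorem induction_on {P : CStarEnvelope b → Prop} (z : CStarEnvelope b)
    (hc : IsClosed {z | P z}) (h : ∀ x, P (ofL b x)) : P z :=
  denseRange_ofL.induction_on z hc h

@[elab_as_elim]
theorem induction_on₂ {P : CStarEnvelope b → CStarEnvelope b → Prop} (z w : CStarEnvelope b)
    (hc : IsClosed {z : CStarEnvelope b × CStarEnvelope b | P z.1 z.2})
    (h : ∀ x y, P (ofL b x) (ofL b y)) : P z w :=
  denseRange_ofL.induction_on₂ hc h z w

variable (b) in
/-- The canonical *-homomorphism of `X` into its enveloping C*-algebra. -/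
def of : X →⋆ₙₐ[ℂ] CStarEnvelope b :=
  { ofL b with
    map_zero' := map_zero (ofL b)
    map_mul' := ofL_mul
    map_star' := ofL_star }

theorem of_apply (x : X) : of b x = ofL b x := rfl

variable {c} in
theorem maxCStarSeminorm_map_le (f : X →⋆ₙₐ[ℂ] Y) (hf : ∀ x, c (f x) ≤ b x) (x : X) :
    maxCStarSeminorm c (f x) ≤ maxCStarSeminorm b x := by
  refine maxCStarSeminorm_le (apply_nonneg _ _) fun p hp hc => ?_
  let q : Seminorm ℂ X := p.comp (f : X →ₗ[ℂ] Y)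
  have hq : IsCStarSeminorm q :=
    { map_mul_le := fun x y => by
        change p (f (x * y)) ≤ p (f x) * p (f y)
        rw [map_mul]; exact hp.map_mul_le _ _
      map_star_mul_self := fun x => by
        change p (f (star x * x)) = p (f x) ^ 2
        rw [map_mul, map_star f]; exact hp.map_star_mul_self _ }
  exact le_maxCStarSeminorm hq (fun y => (hc _).trans (hf y)) x

/-- The continuous linear extension underlying `CStarEnvelope.map`. -/
def mapL (f : X →⋆ₙₐ[ℂ] Y) (hf : ∀ x, c (f x) ≤ b x) :
    CStarEnvelope b →L[ℂ] CStarEnvelope c :=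
  ContinuousLinearMap.completion
    (LinearMap.mkContinuous (E := PreEnvelope b) (F := PreEnvelope c)
      (f : X →ₗ[ℂ] Y) 1 fun x => by
        rw [one_mul]; exact maxCStarSeminorm_map_le f hf x)

variable {c}

theorem mapL_ofL (f : X →⋆ₙₐ[ℂ] Y) (hf : ∀ x, c (f x) ≤ b x) (x : X) :
    mapL c f hf (ofL b x) = ofL c (f x) :=
  ContinuousLinearMap.completion_apply_coe _ _

/-- The *-homomorphism of enveloping C*-algebras which extends a *-homomorphism `f : X → Y`
that does not increase the dominating functions. -/
def map (f : X →⋆ₙₐ[ℂ] Y) (hf : ∀ x, c (f x) ≤ b x) :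
    CStarEnvelope b →⋆ₙₐ[ℂ] CStarEnvelope c :=
  { (mapL c f hf).toLinearMap with
    map_zero' := map_zero (mapL c f hf)
    map_mul' := fun x y => by
      change mapL c f hf (x * y) = mapL c f hf x * mapL c f hf y
      refine induction_on₂ x y (isClosed_eq (by fun_prop) (by fun_prop)) fun x y => ?_
      simp only [← ofL_mul, mapL_ofL, map_mul]
    map_star' := fun x => by
      change mapL c f hf (star x) = star (mapL c f hf x)
      refine induction_on x (isClosed_eq (by fun_prop) (by fun_prop)) fun x => ?_
      simp only [← ofL_star, mapL_ofL, map_star f] }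

theorem map_of (f : X →⋆ₙₐ[ℂ] Y) (hf : ∀ x, c (f x) ≤ b x) (x : X) :
    map f hf (of b x) = of c (f x) :=
  mapL_ofL f hf x

end CStarEnvelope
end Envelope

/-! ### Compact operators and tensor products -/

section CompactOperators

variable {H : Type*} [NormedAddCommGroup H] [InnerProductSpace ℂ H] [CompleteSpace H]

theorem isCompactOperator_star {T : H →L[ℂ] H} (hT : IsCompactOperator T) :
    IsCompactOperator (star T : H →L[ℂ] H) := by
  have hc : IsCompactOperator ((T * star T : H →L[ℂ] H) : H →ₗ[ℂ] H) := hT.comp_clm (star T)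
  have h1 := (hc.isCompact_closure_image_closedBall 1).totallyBounded.subset subset_closure
  refine (isCompactOperator_iff_isCompact_closure_image_closedBall
    ((star T : H →L[ℂ] H) : H →ₗ[ℂ] H) one_pos).mpr ?_
  refine TotallyBounded.isCompact_of_isClosed ?_ isClosed_closure
  refine TotallyBounded.closure ?_
  rw [Metric.totallyBounded_iff]
  intro ε hε
  obtain ⟨t, hts, htf, htc⟩ := Metric.finite_approx_of_totallyBounded h1 (ε ^ 2 / 2) (by positivity)
  obtain ⟨t', ht's, ht'f, rfl⟩ := Set.exists_subset_image_finite_and.mp ⟨t, hts, htf, rfl⟩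
  refine ⟨(star T : H →L[ℂ] H) '' t', ht'f.image _, ?_⟩
  rintro _ ⟨x, hx, rfl⟩
  obtain ⟨_, ⟨y, hy, rfl⟩, hxy⟩ := Set.mem_iUnion₂.mp (htc ⟨x, hx, rfl⟩)
  refine Set.mem_iUnion₂.mpr ⟨_, ⟨y, hy, rfl⟩, ?_⟩
  rw [Metric.mem_ball, dist_eq_norm] at hxy ⊢
  have hn : ‖x - y‖ ≤ 2 := by
    have hx' : ‖x‖ ≤ 1 := by simpa using hx
    have hy' : ‖y‖ ≤ 1 := by simpa using ht's hy
    linarith [norm_sub_le x y]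
  change ‖(star T) x - (star T) y‖ < ε
  change ‖T ((star T) x) - T ((star T) y)‖ < ε ^ 2 / 2 at hxy
  rw [← map_sub] at hxy ⊢
  rw [← map_sub] at hxy
  have key : ‖(star T) (x - y)‖ ^ 2 ≤ ‖T ((star T) (x - y))‖ * ‖x - y‖ := by
    have h2 : inner ℂ ((star T) (x - y)) ((star T) (x - y)) =
        inner ℂ (T ((star T) (x - y))) (x - y) := by
      rw [ContinuousLinearMap.star_eq_adjoint, ContinuousLinearMap.adjoint_inner_right]
    calc ‖(star T) (x - y)‖ ^ 2
        = ‖inner ℂ ((star T) (x - y)) ((star T) (x - y))‖ := by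
          rw [inner_self_eq_norm_sq_to_K]; simp
      _ ≤ _ := by rw [h2]; exact norm_inner_le_norm _ _
  have h3 : ‖(star T) (x - y)‖ ^ 2 < ε ^ 2 := by
    nlinarith [norm_nonneg (T ((star T) (x - y))), norm_nonneg (x - y)]
  exact lt_of_pow_lt_pow_left₀ 2 hε.le h3

variable (H) in
/-- The C*-algebra `𝒦(H)` of compact operators on the Hilbert space `H`. -/
def compactOperators : NonUnitalStarSubalgebra ℂ (H →L[ℂ] H) where
  carrier := {T | IsCompactOperator T}
  zero_mem' := isCompactOperator_zero
  add_mem' := fun h1 h2 => IsCompactOperator.add h1 h2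
  mul_mem' := fun {_ S} h1 _ => IsCompactOperator.comp_clm h1 S
  smul_mem' := fun a _ h => IsCompactOperator.smul h a
  star_mem' := fun h => isCompactOperator_star h

instance : IsClosed (compactOperators H : Set (H →L[ℂ] H)) :=
  isClosed_setOfPred_isCompactOperator

end CompactOperators

section Tensor

variable (A B C : Type*) [NonUnitalCStarAlgebra A] [NonUnitalCStarAlgebra B]
  [NonUnitalCStarAlgebra C]

/-- The projective tensor norm on the algebraic tensor product. -/
def projectiveNorm (t : A ⊗[ℂ] B) : ℝ :=
  sInf {r | ∃ l : List (A × B), (l.map fun x => x.1 ⊗ₜ[ℂ] x.2).sum = t ∧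
    (l.map fun x => ‖x.1‖ * ‖x.2‖).sum = r}

/-- The C*-tensor product `A ⊗ B`: the completion of the algebraic tensor product with respect to
the greatest C*-seminorm on it. (Every C*-seminorm `p` on the algebraic tensor product satisfies
`p (a ⊗ b) ≤ ‖a‖ * ‖b‖`, that is, it is dominated by the projective norm.) In this development
`B` is the nuclear C*-algebra of compact operators on a Hilbert space, for which there is only one
C*-norm on the algebraic tensor product. -/
abbrev CStarTensor : Type _ := CStarEnvelope (projectiveNorm A B)

variable {A B}

/-- `φ ⊗ id` on algebraic tensor products. -/
def algTensorMap (φ : A →⋆ₙₐ[ℂ] B) : (A ⊗[ℂ] C) →⋆ₙₐ[ℂ] (B ⊗[ℂ] C) :=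
  { TensorProduct.map (φ : A →ₗ[ℂ] B) (LinearMap.id : C →ₗ[ℂ] C) with
    map_zero' := map_zero _
    map_mul' := fun x y => by
      change TensorProduct.map (φ : A →ₗ[ℂ] B) LinearMap.id (x * y) =
        TensorProduct.map (φ : A →ₗ[ℂ] B) LinearMap.id x *
          TensorProduct.map (φ : A →ₗ[ℂ] B) LinearMap.id y
      induction x using TensorProduct.induction_on with
      | zero => simp
      | add x₁ x₂ h₁ h₂ => simp only [add_mul, map_add, h₁, h₂]
      | tmul a c =>
        induction y using TensorProduct.induction_on with
        | zero => simp
        | add y₁ y₂ h₁ h₂ => simp only [mul_add, map_add, h₁, h₂]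
        | tmul a' c' => simp
    map_star' := fun x => by
      change TensorProduct.map (φ : A →ₗ[ℂ] B) LinearMap.id (star x) =
        star (TensorProduct.map (φ : A →ₗ[ℂ] B) LinearMap.id x)
      induction x using TensorProduct.induction_on with
      | zero => simp
      | add x₁ x₂ h₁ h₂ => simp only [star_add, map_add, h₁, h₂]
      | tmul a c => simp [map_star φ] }

variable {C}

theorem algTensorMap_tmul (φ : A →⋆ₙₐ[ℂ] B) (a : A) (k : C) :
    algTensorMap C φ (a ⊗ₜ k) = φ a ⊗ₜ k := rfl

theorem projectiveNorm_algTensorMap_le (φ : A →⋆ₙₐ[ℂ] B) (t : A ⊗[ℂ] C) :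
    projectiveNorm B C (algTensorMap C φ t) ≤ projectiveNorm A C t := by
  have hne : ∀ t : A ⊗[ℂ] C, ∃ l : List (A × C), (l.map fun x => x.1 ⊗ₜ[ℂ] x.2).sum = t := by
    intro t
    induction t using TensorProduct.induction_on with
    | zero => exact ⟨[], rfl⟩
    | tmul a c => exact ⟨[(a, c)], by simp⟩
    | add x y hx hy =>
      obtain ⟨l, rfl⟩ := hx
      obtain ⟨m, rfl⟩ := hy
      exact ⟨l ++ m, by simp⟩
  obtain ⟨l₀, hl₀⟩ := hne t
  refine le_csInf ⟨_, l₀, hl₀, rfl⟩ ?_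
  rintro _ ⟨l, rfl, rfl⟩
  have hmap : algTensorMap C φ (l.map fun x => x.1 ⊗ₜ[ℂ] x.2).sum =
      ((l.map fun x => (φ x.1, x.2)).map fun x => x.1 ⊗ₜ[ℂ] x.2).sum := by
    rw [map_list_sum, List.map_map, List.map_map]
    rfl
  have hle : ((l.map fun x => (φ x.1, x.2)).map fun x => ‖x.1‖ * ‖x.2‖).sum ≤
      (l.map fun x => ‖x.1‖ * ‖x.2‖).sum := by
    rw [List.map_map]
    refine List.sum_le_sum fun x _ => ?_
    exact mul_le_mul_of_nonneg_right (NonUnitalStarAlgHom.norm_apply_le φ x.1) (norm_nonneg _)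
  refine le_trans (csInf_le ⟨0, ?_⟩ ⟨_, hmap.symm, rfl⟩) hle
  rintro _ ⟨m, -, rfl⟩
  refine List.sum_nonneg fun r hr => ?_
  obtain ⟨x, -, rfl⟩ := List.mem_map.mp hr
  positivity

variable (C) in
/-- The *-homomorphism `φ ⊗ id : A ⊗ C → B ⊗ C`. -/
def CStarTensor.map (φ : A →⋆ₙₐ[ℂ] B) : CStarTensor A C →⋆ₙₐ[ℂ] CStarTensor B C :=
  CStarEnvelope.map (algTensorMap C φ) (projectiveNorm_algTensorMap_le φ)

end Tensor

/-! ### Circle actions and their crossed products -/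

instance : MeasurableSpace Circle := borel Circle

instance : BorelSpace Circle := ⟨rfl⟩

/-- The normalized Haar measure on the circle group. -/
def circleHaar : Measure Circle := Measure.haarMeasure ⊤

instance : circleHaar.IsHaarMeasure := by unfold circleHaar; infer_instance

instance : IsProbabilityMeasure circleHaar :=
  ⟨Measure.haarMeasure_self (G := Circle) (K₀ := ⊤)⟩

/-- The Hilbert space `L²(𝕋)`. -/
abbrev L2Circle : Type := Lp ℂ 2 circleHaar

/-- A continuous action of the circle on the C*-algebra `A`. -/
structure CircleAction (A : Type*) [CStarAlgebra A] where
  toHom : Circle →* (A ≃⋆ₐ[ℂ] A)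
  continuous_apply : ∀ a, Continuous fun ζ => toHom ζ a

namespace CircleAction

variable {A B : Type*} [CStarAlgebra A] [CStarAlgebra B]

instance : CoeFun (CircleAction A) fun _ => Circle → A ≃⋆ₐ[ℂ] A := ⟨fun α => α.toHom⟩

variable (α : CircleAction A) (β : CircleAction B)

theorem mul_apply (ζ η : Circle) (a : A) : α (ζ * η) a = α ζ (α η a) := by
  rw [map_mul, StarAlgEquiv.mul_apply]

theorem one_apply (a : A) : α 1 a = a := by
  rw [_root_.map_one, StarAlgEquiv.one_apply]

/-- The Rokhlin property. -/
def HasRokhlinProperty : Prop :=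
  ∀ ε : ℝ, 0 < ε → ∀ F : Finset A, ∃ u ∈ unitary A,
    (∀ ζ : Circle, ‖α ζ u - (ζ : ℂ) • u‖ < ε) ∧ ∀ a ∈ F, ‖u * a - a * u‖ < ε

/-- The unitaries `u` of `A` with `α_ζ(u) = ζ u` for all `ζ`. -/
def eigenunitaries : Set A :=
  {u | u ∈ unitary A ∧ ∀ ζ : Circle, α ζ u = (ζ : ℂ) • u}

/-- The fixed point algebra `A^α`. -/
def fixedPoints : StarSubalgebra ℂ A where
  carrier := {a | ∀ ζ, α ζ a = a}
  mul_mem' := fun ha hb ζ => by rw [map_mul, ha ζ, hb ζ]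
  add_mem' := fun ha hb ζ => by rw [map_add, ha ζ, hb ζ]
  algebraMap_mem' := fun r ζ => by rw [Algebra.algebraMap_eq_smul_one, map_smul, _root_.map_one]
  star_mem' := fun ha ζ => by rw [map_star, ha ζ]

instance : IsClosed (α.fixedPoints : Set A) := by
  have : (α.fixedPoints : Set A) = ⋂ ζ, {a | α ζ a = a} := by
    ext a; simp [fixedPoints]
  rw [this]
  exact isClosed_iInter fun ζ => isClosed_eq (StarAlgEquiv.isometry (α ζ)).continuous continuous_id

/-- Equivariance of a unital *-homomorphism. -/
def IsEquivariant (φ : A →⋆ₐ[ℂ] B) : Prop := ∀ ζ a, φ (α ζ a) = β ζ (φ a)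

variable {α β} in
/-- The restriction of an equivariant *-homomorphism to the fixed point algebras. -/
def fixedPointsMap (φ : A →⋆ₐ[ℂ] B) (hφ : α.IsEquivariant β φ) :
    α.fixedPoints →⋆ₙₐ[ℂ] β.fixedPoints where
  toFun a := ⟨φ a, fun ζ => by rw [← hφ, a.2 ζ]⟩
  map_smul' r a := Subtype.ext (map_smul φ r (a : A))
  map_zero' := Subtype.ext (map_zero φ)
  map_add' a b := Subtype.ext (map_add φ (a : A) b)
  map_mul' a b := Subtype.ext (map_mul φ (a : A) b)
  map_star' a := Subtype.ext (map_star φ (a : A))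

theorem continuous_uncurry : Continuous fun p : Circle × A => α p.1 p.2 :=
  continuous_prod_of_continuous_lipschitzWith' _ 1
    (fun ζ => (StarAlgEquiv.isometry (α ζ)).lipschitz) α.continuous_apply

@[fun_prop]
theorem continuous_act {T : Type*} [TopologicalSpace T] {f : T → Circle} {g : T → A}
    (hf : Continuous f) (hg : Continuous g) : Continuous fun t => α (f t) (g t) :=
  α.continuous_uncurry.comp (hf.prodMk hg)

/-- `α_ζ` as a continuous linear map. -/
def clm (ζ : Circle) : A →L[ℂ] A where
  toFun := α ζ
  map_add' := map_add _
  map_smul' := map_smul _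
  cont := (StarAlgEquiv.isometry (α ζ)).continuous

theorem act_integral (ζ : Circle) {f : Circle → A} (hf : Integrable f circleHaar) :
    α ζ (∫ s, f s ∂circleHaar) = ∫ s, α ζ (f s) ∂circleHaar :=
  ((α.clm ζ).integral_comp_comm hf).symm

end CircleAction

section Convolution

variable {A B : Type*} [CStarAlgebra A] [CStarAlgebra B]

theorem integrable_circle {E : Type*} [NormedAddCommGroup E] {f : Circle → E}
    (hf : Continuous f) : Integrable f circleHaar :=
  hf.integrable_of_hasCompactSupport (HasCompactSupport.of_compactSpace f)

theorem integrable_circle_prod {E : Type*} [NormedAddCommGroup E] {f : Circle × Circle → E}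
    (hf : Continuous f) : Integrable f (circleHaar.prod circleHaar) :=
  hf.integrable_of_hasCompactSupport (HasCompactSupport.of_compactSpace f)

theorem continuous_circle_integral {T E : Type*} [TopologicalSpace T] [FirstCountableTopology T]
    [LocallyCompactSpace T] [NormedAddCommGroup E] [NormedSpace ℝ E] {f : T → Circle → E}
    (hf : Continuous f.uncurry) : Continuous fun t => ∫ s, f t s ∂circleHaar := by
  simpa using continuous_parametric_integral_of_continuous (μ := circleHaar) hf isCompact_univ

/-- The convolution *-algebra `C(𝕋, A)` of the action `α`:
`(f * g)(t) = ∫ f(s) α_s(g(s⁻¹ t)) ds` and `f*(t) = α_t(f(t⁻¹)*)`. -/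
def ConvAlgebra (_α : CircleAction A) : Type _ := C(Circle, A)

namespace ConvAlgebra

variable (α : CircleAction A) {β : CircleAction B}

instance : AddCommGroup (ConvAlgebra α) := inferInstanceAs (AddCommGroup C(Circle, A))
instance : Module ℂ (ConvAlgebra α) := inferInstanceAs (Module ℂ C(Circle, A))
instance : FunLike (ConvAlgebra α) Circle A := inferInstanceAs (FunLike C(Circle, A) Circle A)
instance : ContinuousMapClass (ConvAlgebra α) Circle A :=
  inferInstanceAs (ContinuousMapClass C(Circle, A) Circle A)

variable {α}

@[ext] theorem ext {f g : ConvAlgebra α} (h : ∀ t, f t = g t) : f = g := DFunLike.ext _ _ h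

@[simp] theorem add_apply (f g : ConvAlgebra α) (t : Circle) : (f + g) t = f t + g t := rfl
@[simp] theorem zero_apply (t : Circle) : (0 : ConvAlgebra α) t = 0 := rfl
@[simp] theorem smul_apply (r : ℂ) (f : ConvAlgebra α) (t : Circle) : (r • f) t = r • f t := rfl

@[fun_prop]
theorem continuous_eval {T : Type*} [TopologicalSpace T] (f : ConvAlgebra α) {g : T → Circle}
    (hg : Continuous g) : Continuous fun t => f (g t) :=
  (map_continuous f).comp hg

instance : Mul (ConvAlgebra α) where
  mul f g :=
    { toFun := fun t => ∫ s, f s * α s (g (s⁻¹ * t)) ∂circleHaar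
      continuous_toFun := continuous_circle_integral (by unfold Function.uncurry; fun_prop) }

instance : Star (ConvAlgebra α) where
  star f :=
    { toFun := fun t => α t (star (f t⁻¹))
      continuous_toFun := by fun_prop }

theorem mul_apply (f g : ConvAlgebra α) (t : Circle) :
    (f * g) t = ∫ s, f s * α s (g (s⁻¹ * t)) ∂circleHaar := rfl

theorem star_apply (f : ConvAlgebra α) (t : Circle) : star f t = α t (star (f t⁻¹)) := rfl

theorem mul_assoc' (f g h : ConvAlgebra α) : f * g * h = f * (g * h) := by
  ext t
  calc (f * g * h) t
      = ∫ s, (∫ r, f r * α r (g (r⁻¹ * s)) ∂circleHaar) * α s (h (s⁻¹ * t)) ∂circleHaar := rfl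
    _ = ∫ s, (∫ r, f r * α r (g (r⁻¹ * s)) * α s (h (s⁻¹ * t)) ∂circleHaar) ∂circleHaar := by
        congr 1 with s
        rw [integral_mul_const_of_integrable (integrable_circle (by fun_prop))]
    _ = ∫ r, (∫ s, f r * α r (g (r⁻¹ * s)) * α s (h (s⁻¹ * t)) ∂circleHaar) ∂circleHaar :=
        integral_integral_swap (integrable_circle_prod (by unfold Function.uncurry; fun_prop))
    _ = ∫ r, (∫ s, f r * α r (g s * α s (h (s⁻¹ * (r⁻¹ * t)))) ∂circleHaar) ∂circleHaar := by
        congr 1 with r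
        rw [← integral_mul_left_eq_self _ r]
        congr 1 with s
        rw [inv_mul_cancel_left, map_mul (α r), ← α.mul_apply, mul_inv_rev, mul_assoc, mul_assoc]
    _ = ∫ r, f r * α r (∫ s, g s * α s (h (s⁻¹ * (r⁻¹ * t))) ∂circleHaar) ∂circleHaar := by
        congr 1 with r
        rw [α.act_integral r (integrable_circle (by fun_prop)),
          integral_const_mul_of_integrable (integrable_circle (by fun_prop))]

theorem star_mul' (f g : ConvAlgebra α) : star (f * g) = star g * star f := by
  ext t
  calc star (f * g) t
      = α t (star (∫ s, f s * α s (g (s⁻¹ * t⁻¹)) ∂circleHaar)) := rfl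
    _ = ∫ s, α t (star (f s * α s (g (s⁻¹ * t⁻¹)))) ∂circleHaar := by
        have h := ((starL' ℝ : A ≃L[ℝ] A) : A →L[ℝ] A).integral_comp_comm
          (μ := circleHaar) (φ := fun s => f s * α s (g (s⁻¹ * t⁻¹)))
          (integrable_circle (by fun_prop))
        rw [← α.act_integral t (integrable_circle (by fun_prop))]
        exact congrArg (α t) h.symm
    _ = ∫ s, α s (star (g s⁻¹)) * α s (α (s⁻¹ * t) (star (f (s⁻¹ * t)⁻¹))) ∂circleHaar := by
        rw [← integral_mul_left_eq_self _ t⁻¹]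
        congr 1 with s
        rw [star_mul, map_mul, ← map_star, ← α.mul_apply, ← α.mul_apply]
        simp only [mul_inv_rev, inv_inv, mul_inv_cancel_left, mul_assoc, mul_inv_cancel, mul_one]
    _ = (star g * star f) t := rfl

instance : NonUnitalRing (ConvAlgebra α) :=
  { (inferInstance : AddCommGroup (ConvAlgebra α)), (inferInstance : Mul (ConvAlgebra α)) with
    zero_mul := fun f => by ext t; simp [mul_apply]
    mul_zero := fun f => by ext t; simp [mul_apply]
    mul_assoc := mul_assoc'
    left_distrib := fun f g h => by
      ext t
      simp only [mul_apply, add_apply, map_add, mul_add]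
      exact integral_add (integrable_circle (by fun_prop)) (integrable_circle (by fun_prop))
    right_distrib := fun f g h => by
      ext t
      simp only [mul_apply, add_apply, add_mul]
      exact integral_add (integrable_circle (by fun_prop)) (integrable_circle (by fun_prop)) }

instance : StarRing (ConvAlgebra α) where
  star_involutive f := by
    ext t
    rw [star_apply, star_apply, ← map_star, ← α.mul_apply, mul_inv_cancel, α.one_apply, star_star,
      inv_inv]
  star_mul := star_mul'
  star_add f g := by
    ext t
    simp [star_apply]

instance : IsScalarTower ℂ (ConvAlgebra α) (ConvAlgebra α) where
  smul_assoc r f g := by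
    ext t
    simp only [smul_eq_mul, mul_apply, smul_apply, smul_mul_assoc]
    exact integral_smul r _

instance : SMulCommClass ℂ (ConvAlgebra α) (ConvAlgebra α) where
  smul_comm r f g := by
    ext t
    simp only [smul_eq_mul, mul_apply, smul_apply, map_smul, mul_smul_comm]
    exact (integral_smul r _).symm

instance : StarModule ℂ (ConvAlgebra α) where
  star_smul r f := by
    ext t
    simp [star_apply]

/-- The `L¹`-norm. -/
def l1Norm (α : CircleAction A) (f : ConvAlgebra α) : ℝ := ∫ t, ‖f t‖ ∂circleHaar

theorem continuous_hom (φ : A →⋆ₐ[ℂ] B) : Continuous φ :=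
  AddMonoidHomClass.continuous_of_bound φ 1 fun a => by
    rw [one_mul]; exact NonUnitalStarAlgHom.norm_apply_le φ a

/-- Composition of a function with a *-homomorphism. -/
def mapFun (φ : A →⋆ₐ[ℂ] B) (f : ConvAlgebra α) : ConvAlgebra β where
  toFun t := φ (f t)
  continuous_toFun := (continuous_hom φ).comp (map_continuous f)

theorem mapFun_apply (φ : A →⋆ₐ[ℂ] B) (f : ConvAlgebra α) (t : Circle) :
    (mapFun φ f : ConvAlgebra β) t = φ (f t) := rfl

theorem mapFun_mul (φ : A →⋆ₐ[ℂ] B) (hφ : α.IsEquivariant β φ) (f g : ConvAlgebra α) :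
    (mapFun φ (f * g) : ConvAlgebra β) = mapFun φ f * mapFun φ g := by
  ext t
  let L : A →L[ℂ] B := ⟨(φ : A →ₗ[ℂ] B), continuous_hom φ⟩
  have h := L.integral_comp_comm (μ := circleHaar) (φ := fun s => f s * α s (g (s⁻¹ * t)))
    (integrable_circle (by fun_prop))
  refine Eq.trans (b := ∫ s, L (f s * α s (g (s⁻¹ * t))) ∂circleHaar) h.symm ?_
  rw [mul_apply]
  congr 1 with s
  rw [mapFun_apply, mapFun_apply, ← hφ, ← map_mul]
  rfl

theorem mapFun_star (φ : A →⋆ₐ[ℂ] B) (hφ : α.IsEquivariant β φ) (f : ConvAlgebra α) :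
    (mapFun φ (star f) : ConvAlgebra β) = star (mapFun φ f) := by
  ext t
  rw [mapFun_apply, star_apply, star_apply, mapFun_apply, hφ, map_star φ]

/-- Composition with an equivariant *-homomorphism, as a *-homomorphism of convolution algebras. -/
def map (φ : A →⋆ₐ[ℂ] B) (hφ : α.IsEquivariant β φ) : ConvAlgebra α →⋆ₙₐ[ℂ] ConvAlgebra β where
  toFun := mapFun φ
  map_smul' r f := by ext t; exact map_smul φ r (f t)
  map_zero' := by ext t; exact map_zero φ
  map_add' f g := by ext t; exact map_add φ (f t) (g t)
  map_mul' := mapFun_mul φ hφ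
  map_star' := mapFun_star φ hφ

theorem map_apply (φ : A →⋆ₐ[ℂ] B) (hφ : α.IsEquivariant β φ) (f : ConvAlgebra α) (t : Circle) :
    map φ hφ f t = φ (f t) := rfl

theorem l1Norm_map_le (φ : A →⋆ₐ[ℂ] B) (hφ : α.IsEquivariant β φ) (f : ConvAlgebra α) :
    l1Norm β (map φ hφ f) ≤ l1Norm α f :=
  integral_mono (integrable_circle (by fun_prop)) (integrable_circle (by fun_prop))
    fun t => NonUnitalStarAlgHom.norm_apply_le φ (f t)

end ConvAlgebra

/-- The (full) crossed product `A ⋊_α 𝕋`: the enveloping C*-algebra of `L¹(𝕋, A)`, obtained as the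
completion of its dense *-subalgebra `C(𝕋, A)` in the greatest C*-seminorm dominated by the
`L¹`-norm. -/
abbrev CrossedProduct (α : CircleAction A) : Type _ := CStarEnvelope (ConvAlgebra.l1Norm α)

/-- The *-homomorphism `φ ⋊ 𝕋 : A ⋊_α 𝕋 → B ⋊_β 𝕋` induced by an equivariant *-homomorphism. -/
def CrossedProduct.map {α : CircleAction A} {β : CircleAction B} (φ : A →⋆ₐ[ℂ] B)
    (hφ : α.IsEquivariant β φ) : CrossedProduct α →⋆ₙₐ[ℂ] CrossedProduct β :=
  CStarEnvelope.map (ConvAlgebra.map φ hφ) (ConvAlgebra.l1Norm_map_le φ hφ)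

end Convolution

end CircleRokhlin

end

universe u

/-! Exact eigenunitary. Take a unitary w with ‖α_ζ(w) − ζw‖ < 1/2 for all ζ. The average x = ∫ s
α_{s⁻¹}(w) ds satisfies α_ζ(x) = ζx by invariance of Haar measure, and ‖w − x‖ ≤ 1/2, so x is
invertible. Since x*x is fixed by the action, so is (x*x)^(-1/2), and u = x (x*x)^(-1/2) is a
unitary with the same eigenvalue (`eigenunitaries_nonempty`).

Isomorphism. Write D = A^α. For d in D the function E_ij(d) : t ↦ tʲ u⁻ⁱ d uʲ has a coefficient of
spectral degree j − i. Orthogonality of characters then gives E_ij(c) E_kl(d) = δ_jk E_il(cd), and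
E_ij(d)* = E_ji(d*), which are the relations of the tensors d ⊗ e_ij (`convUnit_mul`,
`star_convUnit`). So C(𝕋, A) and the algebraic tensor product D ⊗ 𝒦 contain corresponding copies of
the finitely supported matrices over D. Both copies are dense: trigonometric polynomials with
spectral coefficients are L¹-dense in C(𝕋, A), and finite matrices are norm dense in 𝒦.

Comparison of norms. The crossed product and the tensor product are completions in the greatest
C*-seminorms below the L¹-norm and below the projective norm. The comparison available for these
norms has a constant |S|² on matrices with indices in a finite set S, through the largest entry, and
this constant grows with S. It does no harm: a C*-seminorm that is at most C times a
submultiplicative *-invariant seminorm q on a *-subalgebra is at most q there, by passing to the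
powers (x*x)^(2^k) (`IsCStarSeminorm.le_of_le_const_mul`). Hence both norms dominate the same
C*-seminorms on the matrix algebra. By density each of these extends to a C*-seminorm on the larger
algebra under the same bound (`isCStarSeminorm_infSeminorm`). The two completions therefore induce
the same norm on a common dense *-algebra, and are isomorphic.

Naturality. An equivariant φ with φ(u) = v sends E_ij(d), formed with u, to E_ij(φ(d)), formed with
v. The two composites agree on these generators, whose span is dense (`stabilization_map`). -/

noncomputable section

namespace CircleRokhlin

/-! ### Comparison and extension of C*-seminorms -/

section SeminormComparison

variable {W X Y : Type*}
  [NonUnitalRing W] [StarRing W] [Module ℂ W] [IsScalarTower ℂ W W] [SMulCommClass ℂ W W]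
  [StarModule ℂ W]
  [NonUnitalRing X] [StarRing X] [Module ℂ X] [IsScalarTower ℂ X X] [SMulCommClass ℂ X X]
  [StarModule ℂ X]
  [NonUnitalRing Y] [StarRing Y] [Module ℂ Y] [IsScalarTower ℂ Y Y] [SMulCommClass ℂ Y Y]
  [StarModule ℂ Y]

/-- A submultiplicative seminorm with isometric involution. -/
structure IsStarAlgebraSeminorm (q : Seminorm ℂ X) : Prop where
  map_mul_le : ∀ x y, q (x * y) ≤ q x * q y
  map_star : ∀ x, q (star x) = q x

/-- Taking 2^k-th roots sends the constant to 1, as in the spectral radius formula. Only exponents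
2^k occur, since they come from iterating the C*-identity. -/
theorem le_of_pow_two_pow_le {a c C : ℝ} (hc : 0 ≤ c)
    (h : ∀ k : ℕ, a ^ 2 ^ k ≤ C * c ^ 2 ^ k) : a ≤ c := by
  by_contra hlt
  rw [not_le] at hlt
  rcases hc.eq_or_lt with rfl | hc
  · have := h 0
    simp only [pow_zero, pow_one, mul_zero] at this
    exact absurd hlt this.not_gt
  · have hr : 1 < a / c := (one_lt_div hc).mpr hlt
    obtain ⟨n, hn⟩ := pow_unbounded_of_one_lt C hr
    have h1 : (a / c) ^ n ≤ (a / c) ^ 2 ^ n := pow_le_pow_right₀ hr.le n.lt_two_pow_self.le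
    have h2 : (a / c) ^ 2 ^ n ≤ C := by
      rw [div_pow, div_le_iff₀ (by positivity)]
      exact h n
    linarith

/-- On a *-subalgebra on which a C*-seminorm is bounded by a multiple of a submultiplicative
seminorm with isometric involution, it is bounded by that seminorm itself. -/
theorem IsCStarSeminorm.le_of_le_const_mul {p q : Seminorm ℂ X} (hp : IsCStarSeminorm p)
    (hq : IsStarAlgebraSeminorm q) {T : Set X} (hmul : ∀ x ∈ T, ∀ y ∈ T, x * y ∈ T)
    (hstar : ∀ x ∈ T, star x ∈ T) {C : ℝ} (h : ∀ x ∈ T, p x ≤ C * q x) {x : X} (hx : x ∈ T) :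
    p x ≤ q x := by
  -- Here z = (x*x)^(2^k). It is self-adjoint, so the C*-identity computes p z exactly, while
  -- submultiplicativity bounds q z from above. Closure of T under products keeps the constant C the
  -- same for all these powers.
  have key : ∀ k : ℕ, ∃ z ∈ T, star z = z ∧ p z = p (star x * x) ^ 2 ^ k ∧
      q z ≤ q (star x * x) ^ 2 ^ k := by
    intro k
    induction k with
    | zero => exact ⟨star x * x, hmul _ (hstar _ hx) _ hx, by simp, by simp, by simp⟩
    | succ k ih =>
      obtain ⟨z, hz, hzs, hpz, hqz⟩ := ih
      refine ⟨z * z, hmul _ hz _ hz, by rw [star_mul, hzs], ?_, ?_⟩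
      · have := hp.map_star_mul_self z
        rw [hzs] at this
        rw [this, hpz, ← pow_mul, pow_succ]
      · calc q (z * z) ≤ q z * q z := hq.map_mul_le z z
          _ ≤ q (star x * x) ^ 2 ^ k * q (star x * x) ^ 2 ^ k :=
            mul_self_le_mul_self (apply_nonneg _ _) hqz
          _ = _ := by rw [← pow_add, ← two_mul, pow_succ']
  have hy : p (star x * x) ≤ q (star x * x) := by
    refine le_of_pow_two_pow_le (C := |C|) (apply_nonneg _ _) fun k => ?_
    obtain ⟨z, hz, -, hpz, hqz⟩ := key k
    calc p (star x * x) ^ 2 ^ k = p z := hpz.symm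
      _ ≤ C * q z := h z hz
      _ ≤ |C| * q z := mul_le_mul_of_nonneg_right (le_abs_self C) (apply_nonneg _ _)
      _ ≤ _ := mul_le_mul_of_nonneg_left hqz (abs_nonneg C)
  refine (sq_le_sq₀ (apply_nonneg _ _) (apply_nonneg _ _)).mp ?_
  calc p x ^ 2 = p (star x * x) := (hp.map_star_mul_self x).symm
    _ ≤ q (star x * x) := hy
    _ ≤ q (star x) * q x := hq.map_mul_le _ _
    _ = q x ^ 2 := by rw [hq.map_star, sq]

/-- The greatest seminorm on `X` which is dominated by `b`, and by `p` on the image of `f`. -/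
def infSeminorm (b : Seminorm ℂ X) (f : W →ₗ[ℂ] X) (p : Seminorm ℂ W) : Seminorm ℂ X :=
  Seminorm.ofSMulLE (fun x => ⨅ w, (p w + b (x - f w)))
    (le_antisymm (ciInf_le_of_le ⟨0, by rintro _ ⟨w, rfl⟩; positivity⟩ 0 (by simp))
      (Real.iInf_nonneg fun w => by positivity))
    (fun x y => by
      refine le_of_forall_pos_le_add fun ε hε => ?_
      obtain ⟨w, hw⟩ := exists_lt_of_ciInf_lt
        (lt_add_of_pos_right (⨅ w, (p w + b (x - f w))) (half_pos hε))
      obtain ⟨v, hv⟩ := exists_lt_of_ciInf_lt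
        (lt_add_of_pos_right (⨅ w, (p w + b (y - f w))) (half_pos hε))
      refine ciInf_le_of_le ⟨0, by rintro _ ⟨w, rfl⟩; positivity⟩ (w + v) ?_
      have h1 := map_add_le_add p w v
      have h2 := map_add_le_add b (x - f w) (y - f v)
      have h3 : x + y - f (w + v) = (x - f w) + (y - f v) := by rw [map_add]; abel
      rw [h3]
      linarith)
    (fun r x => by
      rw [Real.mul_iInf_of_nonneg (norm_nonneg r)]
      refine le_ciInf fun w => ciInf_le_of_le ⟨0, by rintro _ ⟨w, rfl⟩; positivity⟩ (r • w) ?_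
      rw [map_smul f, ← smul_sub, map_smul_eq_mul, map_smul_eq_mul, mul_add])

theorem infSeminorm_le_add (b : Seminorm ℂ X) (f : W →ₗ[ℂ] X) (p : Seminorm ℂ W) (x : X) (w : W) :
    infSeminorm b f p x ≤ p w + b (x - f w) :=
  ciInf_le ⟨0, by rintro _ ⟨w, rfl⟩; positivity⟩ w

theorem infSeminorm_le (b : Seminorm ℂ X) (f : W →ₗ[ℂ] X) (p : Seminorm ℂ W) (x : X) :
    infSeminorm b f p x ≤ b x := by
  simpa using infSeminorm_le_add b f p x 0

/-- For every v, p w ≤ p (w − v) + p v ≤ b (f w − f v) + p v, so no competitor in the infimum beats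
v = w. Injectivity of f plays no role. -/
theorem infSeminorm_apply_map {b : Seminorm ℂ X} {f : W →ₗ[ℂ] X} {p : Seminorm ℂ W}
    (h : ∀ w, p w ≤ b (f w)) (w : W) : infSeminorm b f p (f w) = p w := by
  refine le_antisymm (by simpa using infSeminorm_le_add b f p (f w) w) ?_
  refine le_ciInf fun v => ?_
  have h1 := h (w - v)
  have h2 := map_add_le_add p (w - v) v
  rw [sub_add_cancel] at h2
  rw [map_sub f] at h1
  linarith

/-- A map with dense range with respect to a seminorm. -/
def HasDenseRange {V : Type*} (b : Seminorm ℂ X) (f : V → X) : Prop :=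
  ∀ x, ∀ ε > 0, ∃ w, b (x - f w) < ε

theorem HasDenseRange.exists_seq {V : Type*} {b : Seminorm ℂ X} {f : V → X} (hf : HasDenseRange b f) (x : X) :
    ∃ w : ℕ → V, Filter.Tendsto (fun n => b (x - f (w n))) Filter.atTop (nhds 0) := by
  choose w hw using fun n : ℕ => hf x (1 / (n + 1)) (by positivity)
  exact ⟨w, squeeze_zero (fun n => apply_nonneg _ _) (fun n => (hw n).le)
    tendsto_one_div_add_atTop_nhds_zero_nat⟩

theorem tendsto_seminorm_of_le {Q b : Seminorm ℂ X} (h : ∀ x, Q x ≤ b x) {x : X} {a : ℕ → X}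
    (ha : Filter.Tendsto (fun n => b (x - a n)) Filter.atTop (nhds 0)) :
    Filter.Tendsto (fun n => Q (a n)) Filter.atTop (nhds (Q x)) := by
  rw [tendsto_iff_norm_sub_tendsto_zero]
  refine squeeze_zero (fun n => norm_nonneg _) (fun n => ?_) ha
  rw [Real.norm_eq_abs]
  refine (abs_sub_map_le_sub Q _ _).trans ?_
  rw [map_sub_rev]
  exact h _

theorem tendsto_seminorm_mul {b : Seminorm ℂ X} (hb : IsStarAlgebraSeminorm b) {x y : X}
    {a c : ℕ → X} (ha : Filter.Tendsto (fun n => b (x - a n)) Filter.atTop (nhds 0))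
    (hc : Filter.Tendsto (fun n => b (y - c n)) Filter.atTop (nhds 0)) :
    Filter.Tendsto (fun n => b (x * y - a n * c n)) Filter.atTop (nhds 0) := by
  have h1 := tendsto_seminorm_of_le (fun z => le_refl (b z)) hc
  have h2 : Filter.Tendsto (fun n => b x * b (y - c n) + b (x - a n) * b (c n)) Filter.atTop
      (nhds (b x * 0 + 0 * b y)) := (hc.const_mul _).add (ha.mul h1)
  rw [mul_zero, zero_mul, add_zero] at h2
  refine squeeze_zero (fun n => apply_nonneg _ _) (fun n => ?_) h2
  have : x * y - a n * c n = x * (y - c n) + (x - a n) * c n := by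
    rw [mul_sub, sub_mul]; abel
  rw [this]
  exact (map_add_le_add b _ _).trans (add_le_add (hb.map_mul_le _ _) (hb.map_mul_le _ _))

/-- On the image of f the infimum is p, so both C*-conditions hold there. They pass to limits
because the infimum is bounded by b, hence continuous for b, and products and stars are continuous
for b. -/
theorem isCStarSeminorm_infSeminorm {b : Seminorm ℂ X} (hb : IsStarAlgebraSeminorm b)
    {f : W →⋆ₙₐ[ℂ] X} (hf : HasDenseRange b f) {p : Seminorm ℂ W} (hp : IsCStarSeminorm p)
    (h : ∀ w, p w ≤ b (f w)) : IsCStarSeminorm (infSeminorm b (f : W →ₗ[ℂ] X) p) where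
  map_mul_le x y := by
    obtain ⟨v, hv⟩ := hf.exists_seq x
    obtain ⟨w, hw⟩ := hf.exists_seq y
    have hQ := infSeminorm_le b (f : W →ₗ[ℂ] X) p
    refine le_of_tendsto_of_tendsto' (tendsto_seminorm_of_le hQ (tendsto_seminorm_mul hb hv hw))
      ((tendsto_seminorm_of_le hQ hv).mul (tendsto_seminorm_of_le hQ hw)) fun n => ?_
    have e : ∀ u, infSeminorm b (f : W →ₗ[ℂ] X) p (f u) = p u := infSeminorm_apply_map h
    rw [← map_mul, e, e, e]
    exact hp.map_mul_le _ _
  map_star_mul_self x := by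
    obtain ⟨v, hv⟩ := hf.exists_seq x
    have hQ := infSeminorm_le b (f : W →ₗ[ℂ] X) p
    have hv' : Filter.Tendsto (fun n => b (star x - star (f (v n)))) Filter.atTop (nhds 0) := by
      simpa only [← star_sub, hb.map_star] using hv
    refine tendsto_nhds_unique (tendsto_seminorm_of_le hQ (tendsto_seminorm_mul hb hv' hv)) ?_
    refine ((tendsto_seminorm_of_le hQ hv).pow 2).congr fun n => ?_
    have e : ∀ u, infSeminorm b (f : W →ₗ[ℂ] X) p (f u) = p u := infSeminorm_apply_map h
    rw [← map_star f, ← map_mul, e, e, hp.map_star_mul_self]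

theorem IsCStarSeminorm.comp {p : Seminorm ℂ X} (hp : IsCStarSeminorm p) (f : W →⋆ₙₐ[ℂ] X) :
    IsCStarSeminorm (p.comp (f : W →ₗ[ℂ] X)) where
  map_mul_le x y := by
    change p (f (x * y)) ≤ p (f x) * p (f y)
    rw [map_mul]; exact hp.map_mul_le _ _
  map_star_mul_self x := by
    change p (f (star x * x)) = p (f x) ^ 2
    rw [map_mul, StarHomClass.map_star f]; exact hp.map_star_mul_self _

theorem IsStarAlgebraSeminorm.comp {p : Seminorm ℂ X} (hp : IsStarAlgebraSeminorm p)
    (f : W →⋆ₙₐ[ℂ] X) : IsStarAlgebraSeminorm (p.comp (f : W →ₗ[ℂ] X)) where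
  map_mul_le x y := by
    change p (f (x * y)) ≤ p (f x) * p (f y)
    rw [map_mul]; exact hp.map_mul_le _ _
  map_star x := by
    change p (f (star x)) = p (f x)
    rw [StarHomClass.map_star f]; exact hp.map_star _

/-- A C*-seminorm below b pulls back to W, is below c ∘ g there by hypothesis, and extends to a
C*-seminorm on Y below c. The extension is one of those in the supremum on the right. -/
theorem maxCStarSeminorm_le_of_hasDenseRange {b : Seminorm ℂ X} {c : Seminorm ℂ Y}
    (hc : IsStarAlgebraSeminorm c) (f : W →⋆ₙₐ[ℂ] X) {g : W →⋆ₙₐ[ℂ] Y} (hg : HasDenseRange c g)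
    (h : ∀ p : Seminorm ℂ W, IsCStarSeminorm p → (∀ w, p w ≤ b (f w)) → ∀ w, p w ≤ c (g w))
    (w : W) : maxCStarSeminorm b (f w) ≤ maxCStarSeminorm c (g w) := by
  refine maxCStarSeminorm_le (apply_nonneg _ _) fun p hp hb => ?_
  have hp' := hp.comp f
  have hpc := h _ hp' fun w => hb (f w)
  calc p (f w) = infSeminorm c (g : W →ₗ[ℂ] Y) (p.comp (f : W →ₗ[ℂ] X)) (g w) :=
        (infSeminorm_apply_map (f := (g : W →ₗ[ℂ] Y)) hpc w).symm
    _ ≤ _ := le_maxCStarSeminorm (isCStarSeminorm_infSeminorm hc hg hp' hpc)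
        (infSeminorm_le _ _ _) _

theorem CStarEnvelope.norm_of_le (b : Seminorm ℂ X) (x : X) : ‖CStarEnvelope.of b x‖ ≤ b x := by
  rw [CStarEnvelope.of_apply, CStarEnvelope.norm_ofL]
  exact maxCStarSeminorm_le (apply_nonneg _ _) fun p _ hb => hb x

/-- The envelope norm is at most b, so approximation for b is approximation in the envelope. -/
theorem HasDenseRange.denseRange_of {V : Type*} {b : Seminorm ℂ X} {f : V → X} (hf : HasDenseRange b f) :
    DenseRange fun w => CStarEnvelope.of b (f w) := by
  intro z
  refine CStarEnvelope.induction_on z isClosed_closure fun x => ?_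
  rw [Metric.mem_closure_iff]
  intro ε hε
  obtain ⟨w, hw⟩ := hf x ε hε
  refine ⟨_, ⟨w, rfl⟩, ?_⟩
  rw [dist_eq_norm, ← CStarEnvelope.of_apply, ← map_sub]
  exact (CStarEnvelope.norm_of_le b _).trans_lt hw

theorem continuous_nonUnitalStarAlgHom {E F : Type*} [NonUnitalCStarAlgebra E]
    [NonUnitalCStarAlgebra F] (f : E →⋆ₙₐ[ℂ] F) : Continuous f :=
  AddMonoidHomClass.continuous_of_bound f 1 fun a => by
    rw [one_mul]; exact NonUnitalStarAlgHom.norm_apply_le f a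

/-- *-homomorphisms on the enveloping C*-algebra which agree on a set with dense linear span are
equal. -/
theorem CStarEnvelope.hom_eq_of_span {F : Type*} [NonUnitalCStarAlgebra F] {b : Seminorm ℂ X}
    {G : Set X} (hG : ∀ x, ∀ ε > 0, ∃ g ∈ Submodule.span ℂ G, b (x - g) < ε)
    (f g : CStarEnvelope b →⋆ₙₐ[ℂ] F)
    (h : ∀ x ∈ G, f (CStarEnvelope.of b x) = g (CStarEnvelope.of b x)) (z : CStarEnvelope b) :
    f z = g z := by
  have hdense : HasDenseRange b fun x : Submodule.span ℂ G => (x : X) := fun x ε hε =>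
    (hG x ε hε).elim fun g hg => ⟨⟨g, hg.1⟩, hg.2⟩
  refine hdense.denseRange_of.induction_on z (isClosed_eq (continuous_nonUnitalStarAlgHom f)
    (continuous_nonUnitalStarAlgHom g)) fun w => ?_
  obtain ⟨w, hw⟩ := w
  change f (CStarEnvelope.of b w) = g (CStarEnvelope.of b w)
  induction hw using Submodule.span_induction with
  | mem x hx => exact h x hx
  | zero => simp only [map_zero]
  | add x y _ _ hx hy => simp only [map_add, hx, hy]
  | smul r x _ hx => simp only [map_smul, hx]

end SeminormComparison

/-! ### Isomorphisms from equal norms on a common dense *-algebra -/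

section ExtendIsometry

variable {W E F : Type*}
  [NonUnitalRing W] [StarRing W] [Module ℂ W]
  [NonUnitalCStarAlgebra E] [NonUnitalCStarAlgebra F]

/-- Two *-homomorphisms with dense ranges that induce the same norm have isomorphic targets. -/
def starAlgEquivOfDense (f : W →⋆ₙₐ[ℂ] E) (g : W →⋆ₙₐ[ℂ] F) (hf : DenseRange f)
    (hg : DenseRange g) (h : ∀ w, ‖g w‖ = ‖f w‖) : E ≃⋆ₐ[ℂ] F :=
  let e : E ≃L[ℂ] F := LinearEquiv.extend (LinearEquiv.refl ℂ W) (f : W →ₗ[ℂ] E) (g : W →ₗ[ℂ] F)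
    hf ⟨1, fun w => by rw [one_mul]; exact (h w).le⟩ hg
    ⟨1, fun w => by rw [one_mul]; exact (h w).ge⟩
  have he : ∀ w, e (f w) = g w := fun w => LinearEquiv.extend_eq (LinearEquiv.refl ℂ W)
    (f : W →ₗ[ℂ] E) (g : W →ₗ[ℂ] F) _ _ _ _ w
  { e with
    map_mul' := fun x y => by
      change e (x * y) = e x * e y
      refine hf.induction_on₂ (isClosed_eq (by fun_prop) (by fun_prop)) (fun v w => ?_) x y
      rw [← map_mul, he, he, he, map_mul]
    map_star' := fun x => by
      change e (star x) = star (e x)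
      refine hf.induction_on x (isClosed_eq (by fun_prop) (by fun_prop)) fun w => ?_
      rw [← map_star f, he, he, map_star g]
    map_smul' := fun r x => map_smul e r x }

theorem starAlgEquivOfDense_apply (f : W →⋆ₙₐ[ℂ] E) (g : W →⋆ₙₐ[ℂ] F) (hf : DenseRange f)
    (hg : DenseRange g) (h : ∀ w, ‖g w‖ = ‖f w‖) (w : W) :
    starAlgEquivOfDense f g hf hg h (f w) = g w :=
  LinearEquiv.extend_eq (LinearEquiv.refl ℂ W) (f : W →ₗ[ℂ] E) (g : W →ₗ[ℂ] F) _ _ _ _ w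

end ExtendIsometry

/-! ### Isomorphic envelopes from locally equivalent seminorms -/

section EnvelopeEquiv

variable {W X Y : Type*}
  [NonUnitalRing W] [StarRing W] [Module ℂ W] [IsScalarTower ℂ W W] [SMulCommClass ℂ W W]
  [StarModule ℂ W]
  [NonUnitalRing X] [StarRing X] [Module ℂ X] [IsScalarTower ℂ X X] [SMulCommClass ℂ X X]
  [StarModule ℂ X]
  [NonUnitalRing Y] [StarRing Y] [Module ℂ Y] [IsScalarTower ℂ Y Y] [SMulCommClass ℂ Y Y]
  [StarModule ℂ Y]

/-- Every element lies in a *-closed and multiplicatively closed set on which the first function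
is dominated by a multiple of the second one. -/
def IsLocallyDominated (b c : W → ℝ) : Prop :=
  ∀ w, ∃ T : Set W, w ∈ T ∧ (∀ x ∈ T, ∀ y ∈ T, x * y ∈ T) ∧ (∀ x ∈ T, star x ∈ T) ∧
    ∃ C : ℝ, ∀ x ∈ T, b x ≤ C * c x

/-- The constant may depend on w: `IsCStarSeminorm.le_of_le_const_mul` replaces it by 1 for each w
separately, which leaves a global inequality. -/
theorem maxCStarSeminorm_le_of_isLocallyDominated {b : Seminorm ℂ X} {c : Seminorm ℂ Y}
    (hc : IsStarAlgebraSeminorm c) (f : W →⋆ₙₐ[ℂ] X) {g : W →⋆ₙₐ[ℂ] Y} (hg : HasDenseRange c g)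
    (h : IsLocallyDominated (fun w => b (f w)) fun w => c (g w)) (w : W) :
    maxCStarSeminorm b (f w) ≤ maxCStarSeminorm c (g w) := by
  refine maxCStarSeminorm_le_of_hasDenseRange hc f hg (fun p hp hpb w => ?_) w
  obtain ⟨T, hw, hmul, hstar, C, hC⟩ := h w
  exact hp.le_of_le_const_mul (hc.comp g) hmul hstar (fun x hx => (hpb x).trans (hC x hx)) hw

variable {b : Seminorm ℂ X} {c : Seminorm ℂ Y}
  (hb : IsStarAlgebraSeminorm b) (hc : IsStarAlgebraSeminorm c) {f : W →⋆ₙₐ[ℂ] X}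
  {g : W →⋆ₙₐ[ℂ] Y} (hf : HasDenseRange b f) (hg : HasDenseRange c g)
  (hbc : IsLocallyDominated (fun w => b (f w)) fun w => c (g w))
  (hcb : IsLocallyDominated (fun w => c (g w)) fun w => b (f w))

/-- Two *-algebras which contain dense copies of the same *-algebra, on which the dominating
seminorms are locally equivalent, have isomorphic enveloping C*-algebras. -/
def envelopeEquiv : CStarEnvelope b ≃⋆ₐ[ℂ] CStarEnvelope c :=
  starAlgEquivOfDense ((CStarEnvelope.of b).comp f) ((CStarEnvelope.of c).comp g)
    hf.denseRange_of hg.denseRange_of fun w => by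
      change ‖CStarEnvelope.ofL _ (g w)‖ = ‖CStarEnvelope.ofL _ (f w)‖
      rw [CStarEnvelope.norm_ofL, CStarEnvelope.norm_ofL]
      exact le_antisymm (maxCStarSeminorm_le_of_isLocallyDominated hb g hf hcb w)
        (maxCStarSeminorm_le_of_isLocallyDominated hc f hg hbc w)

theorem envelopeEquiv_of (w : W) :
    envelopeEquiv hb hc hf hg hbc hcb (CStarEnvelope.of b (f w)) = CStarEnvelope.of c (g w) :=
  starAlgEquivOfDense_apply ((CStarEnvelope.of b).comp f) ((CStarEnvelope.of c).comp g) _ _ _ w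

/-! ### The common *-algebra as a subalgebra of a product, with its two coordinate maps -/

section Pairs

variable {V : NonUnitalStarSubalgebra ℂ (X × Y)}
  (hV : ∀ z ∈ V, ∃ T : NonUnitalStarSubalgebra ℂ (X × Y), z ∈ T ∧
    ∃ C : ℝ, ∀ x ∈ T, b x.1 ≤ C * c x.2 ∧ c x.2 ≤ C * b x.1)
  (hV₁ : ∀ x, ∀ ε > 0, ∃ z ∈ V, b (x - z.1) < ε) (hV₂ : ∀ y, ∀ ε > 0, ∃ z ∈ V, c (y - z.2) < ε)

/-- Two *-algebras which contain dense copies of the same *-algebra, on which the dominating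
seminorms are locally equivalent, have isomorphic enveloping C*-algebras. Here the common
*-algebra is given as a correspondence. -/
def envelopeEquivOfPairs : CStarEnvelope b ≃⋆ₐ[ℂ] CStarEnvelope c :=
  envelopeEquiv hb hc
    (f := (NonUnitalStarAlgHom.fst ℂ X Y).comp (NonUnitalStarSubalgebraClass.subtype V))
    (g := (NonUnitalStarAlgHom.snd ℂ X Y).comp (NonUnitalStarSubalgebraClass.subtype V))
    (fun x ε hε => (hV₁ x ε hε).elim fun z hz => ⟨⟨z, hz.1⟩, hz.2⟩)
    (fun y ε hε => (hV₂ y ε hε).elim fun z hz => ⟨⟨z, hz.1⟩, hz.2⟩)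
    (fun w => by
      obtain ⟨T, hw, C, hC⟩ := hV w w.2
      exact ⟨{w | (w : X × Y) ∈ T}, hw, fun _ hx _ hy => mul_mem (s := T) hx hy,
        fun _ hx => star_mem (s := T) hx, C, fun x hx => (hC x hx).1⟩)
    (fun w => by
      obtain ⟨T, hw, C, hC⟩ := hV w w.2
      exact ⟨{w | (w : X × Y) ∈ T}, hw, fun _ hx _ hy => mul_mem (s := T) hx hy,
        fun _ hx => star_mem (s := T) hx, C, fun x hx => (hC x hx).2⟩)

theorem envelopeEquivOfPairs_of {z : X × Y} (hz : z ∈ V) :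
    envelopeEquivOfPairs hb hc hV hV₁ hV₂ (CStarEnvelope.of b z.1) = CStarEnvelope.of c z.2 :=
  envelopeEquiv_of hb hc
    (f := (NonUnitalStarAlgHom.fst ℂ X Y).comp (NonUnitalStarSubalgebraClass.subtype V))
    (g := (NonUnitalStarAlgHom.snd ℂ X Y).comp (NonUnitalStarSubalgebraClass.subtype V))
    _ _ _ _ ⟨z, hz⟩

end Pairs

end EnvelopeEquiv

section SeminormSum

variable {X : Type*} [AddCommGroup X] [Module ℂ X]

theorem seminorm_sum_sum_le (p : Seminorm ℂ X) {ι : Type*} (S : Finset ι) {x : ι → ι → X} {C : ℝ}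
    (h : ∀ i ∈ S, ∀ j ∈ S, p (x i j) ≤ C) :
    p (∑ i ∈ S, ∑ j ∈ S, x i j) ≤ (S.card * S.card : ℝ) * C := by
  have key : ∀ (y : ι → X) (D : ℝ), (∀ i ∈ S, p (y i) ≤ D) → p (∑ i ∈ S, y i) ≤ S.card * D := by
    intro y D hD
    rw [← nsmul_eq_mul]
    exact (Finset.le_sum_of_subadditive p (map_zero p).le (map_add_le_add p) S y).trans
      (Finset.sum_le_card_nsmul _ _ _ hD)
  rw [mul_assoc]
  exact key _ _ fun i hi => key _ _ (h i hi)

end SeminormSum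

/-! ### Trigonometric polynomials on the circle -/

section Trigonometric

variable {E : Type*} [NormedAddCommGroup E] [NormedSpace ℂ E]

theorem exists_circle_zpow_ne_one {n : ℤ} (hn : n ≠ 0) : ∃ s : Circle, s ^ n ≠ 1 := by
  -- The n-th power of this point is exp(iπ) = −1.
  refine ⟨Circle.exp (Real.pi / n), ?_⟩
  rw [← Circle.exp_zsmul, zsmul_eq_mul, mul_div_cancel₀ _ (by exact_mod_cast hn)]
  intro h
  have := congrArg (fun z : Circle => (z : ℂ)) h
  simp only [Circle.coe_exp, Complex.exp_pi_mul_I, Circle.coe_one] at this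
  norm_num at this

/-- The function `t ↦ tᵐ a`. -/
def trigMonomial (m : ℤ) (a : E) : C(Circle, E) where
  toFun t := ((t ^ m : Circle) : ℂ) • a
  continuous_toFun := ((continuous_subtype_val.comp (continuous_zpow m) :
    Continuous fun t : Circle => ((t ^ m : Circle) : ℂ))).smul continuous_const

theorem trigMonomial_apply (m : ℤ) (a : E) (t : Circle) :
    trigMonomial m a t = ((t ^ m : Circle) : ℂ) • a := rfl

/-- Translation by s multiplies the integral by sⁿ but leaves it unchanged by invariance of Haar
measure. Choosing s with sⁿ ≠ 1 forces it to vanish. -/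
theorem integral_zpow_smul_of_ne_zero [CompleteSpace E] {n : ℤ} (hn : n ≠ 0) (a : E) :
    ∫ t : Circle, ((t ^ n : Circle) : ℂ) • a ∂circleHaar = 0 := by
  obtain ⟨s, hs⟩ := exists_circle_zpow_ne_one hn
  have h : ∫ t : Circle, ((t ^ n : Circle) : ℂ) • a ∂circleHaar =
      ((s ^ n : Circle) : ℂ) • ∫ t : Circle, ((t ^ n : Circle) : ℂ) • a ∂circleHaar := by
    conv_lhs => rw [← integral_mul_left_eq_self _ s]
    rw [← integral_smul]
    simp only [mul_zpow, Circle.coe_mul, mul_smul]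
  have h' : (1 - ((s ^ n : Circle) : ℂ)) •
      ∫ t : Circle, ((t ^ n : Circle) : ℂ) • a ∂circleHaar = 0 := by
    rw [sub_smul, one_smul, ← h, sub_self]
  refine (smul_eq_zero.mp h').resolve_left fun h0 => hs ?_
  exact Circle.ext (by rw [Circle.coe_one]; exact (sub_eq_zero.mp h0).symm)

theorem integral_zpow_smul [CompleteSpace E] (n : ℤ) (a : E) :
    ∫ t : Circle, ((t ^ n : Circle) : ℂ) • a ∂circleHaar = if n = 0 then a else 0 := by
  split_ifs with hn
  · simp [hn]
  · exact integral_zpow_smul_of_ne_zero hn a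

/-- Density of the Fourier monomials on `AddCircle 1`, carried over by the homeomorphism with the
circle. -/
theorem mem_closure_span_trigMonomial_complex (f : C(Circle, ℂ)) :
    f ∈ (Submodule.span ℂ (Set.range fun m : ℤ => trigMonomial m (1 : ℂ))).topologicalClosure := by
  have : Fact (0 < (1 : ℝ)) := ⟨one_pos⟩
  let h : AddCircle (1 : ℝ) ≃ₜ Circle := AddCircle.homeomorphCircle one_ne_zero
  let L : C(AddCircle (1 : ℝ), ℂ) →L[ℂ] C(Circle, ℂ) :=
    { toFun := fun g => g.comp ⟨h.symm, h.symm.continuous⟩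
      map_add' := fun _ _ => rfl
      map_smul' := fun _ _ => rfl
      cont := ContinuousMap.continuous_precomp _ }
  have hL : ∀ n : ℤ, L (fourier n) = trigMonomial n 1 := by
    intro n
    ext t
    obtain ⟨x, rfl⟩ := h.surjective t
    change fourier n (h.symm (h x)) = ((h x ^ n : Circle) : ℂ) • (1 : ℂ)
    rw [h.symm_apply_apply, fourier_apply, AddCircle.toCircle_zsmul, smul_eq_mul, mul_one,
      AddCircle.homeomorphCircle_apply]
  have hf : f = L (f.comp ⟨h, h.continuous⟩) := by
    ext t
    change f t = f (h (h.symm t))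
    rw [h.apply_symm_apply]
  have htop : f.comp ⟨h, h.continuous⟩ ∈
      closure (Submodule.span ℂ (Set.range (fourier (T := 1))) : Set C(AddCircle (1 : ℝ), ℂ)) := by
    rw [← Submodule.topologicalClosure_coe, span_fourier_closure_eq_top]
    trivial
  rw [hf]
  refine map_mem_closure L.continuous htop fun g hg => ?_
  induction hg using Submodule.span_induction with
  | mem g hg =>
    obtain ⟨m, rfl⟩ := hg
    exact Submodule.subset_span ⟨m, (hL m).symm⟩
  | zero => rw [map_zero]; exact Submodule.zero_mem _
  | add x y _ _ hx hy => rw [map_add]; exact Submodule.add_mem _ hx hy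
  | smul r x _ hx => rw [map_smul]; exact Submodule.smul_mem _ r hx

theorem smul_const_mem_closure_span_trigMonomial (f : C(Circle, ℂ)) (a : E) :
    (⟨fun t => f t • a, by fun_prop⟩ : C(Circle, E)) ∈
      (Submodule.span ℂ {g : C(Circle, E) | ∃ m b, g = trigMonomial m b}).topologicalClosure := by
  let L : C(Circle, ℂ) →L[ℂ] C(Circle, E) :=
    (ContinuousLinearMap.toSpanSingleton ℂ a).compLeftContinuous ℂ Circle
  refine map_mem_closure (f := L) L.continuous (mem_closure_span_trigMonomial_complex f)
    fun g hg => ?_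
  induction hg using Submodule.span_induction with
  | mem g hg =>
    obtain ⟨m, rfl⟩ := hg
    refine Submodule.subset_span ⟨m, a, ?_⟩
    ext t
    change (((t ^ m : Circle) : ℂ) • (1 : ℂ)) • a = ((t ^ m : Circle) : ℂ) • a
    rw [smul_eq_mul, mul_one]
  | zero => rw [map_zero]; exact Submodule.zero_mem _
  | add x y _ _ hx hy => rw [map_add]; exact Submodule.add_mem _ hx hy
  | smul r x _ hx => rw [map_smul]; exact Submodule.smul_mem _ r hx

/-- The trigonometric polynomials with coefficients in `E` are dense in `C(𝕋, E)`. -/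
theorem mem_closure_span_trigMonomial (f : C(Circle, E)) :
    f ∈ closure (Submodule.span ℂ {g : C(Circle, E) | ∃ m b, g = trigMonomial m b} :
      Set C(Circle, E)) := by
  -- The closed span is replaced by its own closure, so that approximants from the closed span are
  -- allowed.
  rw [← Submodule.topologicalClosure_coe, ← closure_eq_iff_isClosed.mpr
    (Submodule.isClosed_topologicalClosure _), Metric.mem_closure_iff]
  intro ε hε
  -- A partition of unity subordinate to sets on which f varies by less than ε/2 approximates f by Σ
  -- ρ_i f(i). Each term is a scalar function times a fixed vector, which is the case already
  -- settled.
  let U : Circle → Set Circle := fun x => {y | ‖f y - f x‖ < ε / 2}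
  have hU : ∀ x, IsOpen (U x) := fun x => isOpen_lt (by fun_prop) (by fun_prop)
  obtain ⟨s, hs⟩ := isCompact_univ.elim_finite_subcover U hU
    fun x _ => Set.mem_iUnion.mpr ⟨x, by simp [U, half_pos hε]⟩
  obtain ⟨ρ, hρ⟩ := PartitionOfUnity.exists_isSubordinate isClosed_univ (fun i : s => U i)
    (fun i => hU i) (fun x hx => by simpa using hs hx)
  let h : s → C(Circle, E) := fun i =>
    ⟨fun t => ((⟨fun t => ((ρ i t : ℝ) : ℂ), by fun_prop⟩ : C(Circle, ℂ)) t) • f i, by fun_prop⟩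
  refine ⟨∑ i, h i, Submodule.sum_mem _ fun i _ => ?_, ?_⟩
  · exact smul_const_mem_closure_span_trigMonomial
      (⟨fun t => ((ρ i t : ℝ) : ℂ), by fun_prop⟩ : C(Circle, ℂ)) (f i)
  · rw [dist_eq_norm]
    refine lt_of_le_of_lt ((ContinuousMap.norm_le _ (half_pos hε).le).mpr fun t => ?_)
      (half_lt_self hε)
    have hsum : ∑ i, ρ i t = 1 := by
      rw [← finsum_eq_sum_of_fintype]
      exact ρ.sum_eq_one (Set.mem_univ t)
    have e : (f - ∑ i, h i) t = ∑ i, ((ρ i t : ℝ) : ℂ) • (f t - f i) := by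
      simp only [smul_sub, Finset.sum_sub_distrib, ← Finset.sum_smul, ← Complex.ofReal_sum, hsum,
        Complex.ofReal_one, one_smul, ContinuousMap.sub_apply, ContinuousMap.sum_apply]
      rfl
    rw [e]
    calc ‖∑ i, ((ρ i t : ℝ) : ℂ) • (f t - f i)‖ ≤ ∑ i, ρ i t * (ε / 2) := by
          refine norm_sum_le_of_le _ fun i _ => ?_
          rw [norm_smul, Complex.norm_real, Real.norm_of_nonneg (ρ.nonneg i t)]
          by_cases h0 : ρ i t = 0
          · simp [h0]
          · exact mul_le_mul_of_nonneg_left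
              (hρ i (subset_closure (Function.mem_support.mpr h0))).le (ρ.nonneg i t)
      _ = ε / 2 := by rw [← Finset.sum_mul, hsum, one_mul]

end Trigonometric

/-! ### Spectral subspaces of a circle action -/

namespace CircleAction

variable {A B : Type*} [CStarAlgebra A] [CStarAlgebra B] (α : CircleAction A)

/-- The averaging operator `q ↦ ∫ α_s⁻¹(q(s)) ds`. -/
def average (q : C(Circle, A)) : A := ∫ s, α s⁻¹ (q s) ∂circleHaar

theorem average_add (p q : C(Circle, A)) : α.average (p + q) = α.average p + α.average q := by
  simp only [average, ContinuousMap.add_apply, map_add]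
  exact integral_add (integrable_circle (by fun_prop)) (integrable_circle (by fun_prop))

theorem average_smul (r : ℂ) (q : C(Circle, A)) : α.average (r • q) = r • α.average q := by
  simp only [average, ContinuousMap.smul_apply, map_smul]
  exact integral_smul _ _

theorem norm_average_le (q : C(Circle, A)) : ‖α.average q‖ ≤ ‖q‖ := by
  refine (norm_integral_le_of_norm_le_const (C := ‖q‖) (.of_forall fun s => ?_)).trans (by simp)
  rw [StarAlgEquiv.norm_map]
  exact q.norm_coe_le_norm s

/-- This makes averaging a left inverse of a ↦ (s ↦ α_s(a)), so that approximating an orbit function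
in C(𝕋, A) approximates a itself. -/
theorem average_orbit (a : A) : α.average ⟨fun s => α s a, α.continuous_apply a⟩ = a := by
  have h : ∀ s : Circle, α s⁻¹ (α s a) = a := fun s => by
    rw [← α.mul_apply, inv_mul_cancel, α.one_apply]
  simp only [average, ContinuousMap.coe_mk, h]
  simp

/-- The spectral subspace `{a | α_ζ(a) = ζⁿ a}`. -/
def IsSpectral (n : ℤ) (a : A) : Prop := ∀ ζ : Circle, α ζ a = ((ζ ^ n : Circle) : ℂ) • a

/-- The substitution s ↦ ζs in ∫ sᵐ α_{ζs⁻¹}(b) ds pulls out the factor ζᵐ. -/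
theorem isSpectral_average_trigMonomial (m : ℤ) (b : A) :
    α.IsSpectral m (α.average (trigMonomial m b)) := by
  intro ζ
  rw [average, α.act_integral ζ (integrable_circle (by fun_prop)), ← integral_smul,
    ← integral_mul_left_eq_self _ ζ]
  congr 1 with s
  rw [← α.mul_apply, trigMonomial_apply, trigMonomial_apply, map_smul, map_smul, smul_smul,
    ← Circle.coe_mul, ← mul_zpow]
  rw [mul_inv_rev, mul_inv_cancel_comm_assoc]

/-- Averaging is contractive, sends the orbit function of a to a, and sends trigonometric
polynomials to sums of spectral elements. Density of trigonometric polynomials in C(𝕋, A) then does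
the work of a summability kernel. -/
theorem mem_closure_span_isSpectral (a : A) :
    a ∈ closure (Submodule.span ℂ {b | ∃ n, α.IsSpectral n b} : Set A) := by
  let R : C(Circle, A) →L[ℂ] A :=
    LinearMap.mkContinuous ⟨⟨α.average, α.average_add⟩, α.average_smul⟩ 1
      fun q => by rw [one_mul]; exact α.norm_average_le q
  have hR : ∀ q, R q = α.average q := fun q => rfl
  rw [← α.average_orbit a, ← hR]
  refine map_mem_closure R.continuous (mem_closure_span_trigMonomial _) fun g hg => ?_
  induction hg using Submodule.span_induction with
  | mem g hg =>
    obtain ⟨m, b, rfl⟩ := hg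
    exact Submodule.subset_span ⟨m, α.isSpectral_average_trigMonomial m b⟩
  | zero => rw [map_zero]; exact Submodule.zero_mem _
  | add x y _ _ hx hy => rw [map_add]; exact Submodule.add_mem _ hx hy
  | smul r x _ hx => rw [map_smul]; exact Submodule.smul_mem _ r hx

end CircleAction

/-! ### Matrix units in the compact operators -/

section MatrixUnits

open InnerProductSpace Filter Topology

variable {H : Type*} [NormedAddCommGroup H] [InnerProductSpace ℂ H] [CompleteSpace H]

theorem isCompactOperator_rankOne (x y : H) : IsCompactOperator (rankOne ℂ x y : H →L[ℂ] H) := by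
  refine ⟨(fun c : ℂ => c • x) '' Metric.closedBall 0 1,
    (isCompact_closedBall 0 1).image (by fun_prop), ?_⟩
  have hc : Continuous fun z : H => inner ℂ y z := by fun_prop
  have h0 : Metric.closedBall (0 : ℂ) 1 ∈ 𝓝 (inner ℂ y (0 : H)) := by
    rw [inner_zero_right]
    exact Metric.closedBall_mem_nhds 0 one_pos
  filter_upwards [hc.continuousAt h0] with z hz
  exact ⟨inner ℂ y z, hz, by simp⟩

variable {ι : Type*} (e : HilbertBasis ι ℂ H)

/-- The projection onto the span of the basis vectors indexed by `S`. -/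
def basisProj (S : Finset ι) : H →L[ℂ] H := ∑ i ∈ S, rankOne ℂ (e i) (e i)

theorem tendsto_basisProj (x : H) : Tendsto (fun S => basisProj e S x) atTop (𝓝 x) := by
  have h := e.hasSum_repr x
  refine Tendsto.congr (fun S => ?_) h
  simp [basisProj, HilbertBasis.repr_apply_apply]

theorem inner_basis [DecidableEq ι] (i j : ι) : inner ℂ (e i) (e j) = if i = j then (1 : ℂ) else 0 :=
  orthonormal_iff_ite.mp e.orthonormal i j

theorem star_basisProj (S : Finset ι) : star (basisProj e S) = basisProj e S := by
  rw [basisProj, star_sum]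
  refine Finset.sum_congr rfl fun i _ => ?_
  rw [ContinuousLinearMap.star_eq_adjoint, adjoint_rankOne]

theorem basisProj_mul_self (S : Finset ι) : basisProj e S * basisProj e S = basisProj e S := by
  classical
  rw [basisProj, Finset.sum_mul_sum]
  refine Finset.sum_congr rfl fun i hi => ?_
  rw [Finset.sum_eq_single i]
  · rw [ContinuousLinearMap.mul_def, rankOne_comp_rankOne, inner_basis, if_pos rfl, one_smul]
  · intro j _ hj
    rw [ContinuousLinearMap.mul_def, rankOne_comp_rankOne, inner_basis, if_neg hj.symm, zero_smul]
  · exact fun h => absurd hi h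

theorem norm_basisProj_le (S : Finset ι) : ‖basisProj e S‖ ≤ 1 := by
  have h := CStarRing.norm_star_mul_self (x := basisProj e S)
  rw [star_basisProj, basisProj_mul_self] at h
  nlinarith [norm_nonneg (basisProj e S)]

/-- The projections converge strongly to 1 and are contractions, so the convergence is uniform on
totally bounded sets, here the image of the unit ball under T. -/
theorem eventually_norm_sub_basisProj_mul {T : H →L[ℂ] H} (hT : IsCompactOperator T) {ε : ℝ}
    (hε : 0 < ε) : ∀ᶠ S in atTop, ‖T - basisProj e S * T‖ ≤ ε := by
  have h1 := ((IsCompactOperator.isCompact_closure_image_closedBall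
    (f := (T : H →ₗ[ℂ] H)) hT 1).totallyBounded.subset subset_closure)
  obtain ⟨t, htf, ht⟩ := Metric.totallyBounded_iff.mp h1 (ε / 4) (by positivity)
  have h2 : ∀ᶠ S in atTop, ∀ y ∈ t, ‖y - basisProj e S y‖ < ε / 4 := by
    rw [Filter.eventually_all_finite htf]
    intro y _
    have := (tendsto_basisProj e y).eventually (Metric.ball_mem_nhds y (by positivity : 0 < ε / 4))
    filter_upwards [this] with S hS
    rw [← dist_eq_norm, dist_comm]
    exact hS
  filter_upwards [h2] with S hS
  refine ContinuousLinearMap.opNorm_le_of_unit_norm hε.le fun x hx => ?_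
  obtain ⟨y, hy, hxy⟩ := Set.mem_iUnion₂.mp (ht ⟨x, by simp [hx], rfl⟩)
  rw [Metric.mem_ball, dist_eq_norm] at hxy
  change ‖T x - y‖ < ε / 4 at hxy
  -- Three errors of size ε/4: T x − y, its projection, and the defect at the net point y.
  have e1 : (T - basisProj e S * T) x =
      (T x - y) - basisProj e S (T x - y) + (y - basisProj e S y) := by
    simp only [sub_apply, mul_apply_eq_comp, map_sub]
    abel
  have h3 : ‖basisProj e S (T x - y)‖ ≤ ‖T x - y‖ := by
    simpa using (basisProj e S).le_of_opNorm_le (norm_basisProj_le e S) (T x - y)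
  rw [e1]
  have := norm_add_le ((T x - y) - basisProj e S (T x - y)) (y - basisProj e S y)
  have := norm_sub_le (T x - y) (basisProj e S (T x - y))
  linarith [hS y hy]

/-- The matrix units of the compact operators with respect to an orthonormal basis. -/
def matrixUnit (i j : ι) : compactOperators H :=
  ⟨rankOne ℂ (e i) (e j), isCompactOperator_rankOne _ _⟩

theorem coe_matrixUnit (i j : ι) : (matrixUnit e i j : H →L[ℂ] H) = rankOne ℂ (e i) (e j) := rfl

theorem norm_matrixUnit (i j : ι) : ‖matrixUnit e i j‖ = 1 := by
  change ‖rankOne ℂ (e i) (e j)‖ = 1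
  rw [norm_rankOne, e.orthonormal.1, e.orthonormal.1, one_mul]

theorem star_matrixUnit (i j : ι) : star (matrixUnit e i j) = matrixUnit e j i := by
  refine Subtype.ext ?_
  change star (rankOne ℂ (e i) (e j)) = rankOne ℂ (e j) (e i)
  rw [ContinuousLinearMap.star_eq_adjoint, adjoint_rankOne]

theorem matrixUnit_mul_matrixUnit [DecidableEq ι] (i j k l : ι) :
    matrixUnit e i j * matrixUnit e k l = if j = k then matrixUnit e i l else 0 := by
  refine Subtype.ext ?_
  change (rankOne ℂ (e i) (e j) * rankOne ℂ (e k) (e l) : H →L[ℂ] H) = _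
  rw [ContinuousLinearMap.mul_def, rankOne_comp_rankOne, inner_basis]
  split_ifs
  · rw [one_smul, coe_matrixUnit]
  · rw [zero_smul]; rfl

/-- The matrix entries of a compact operator. -/
def matrixEntry (i j : ι) : compactOperators H →ₗ[ℂ] ℂ where
  toFun T := inner ℂ (e i) ((T : H →L[ℂ] H) (e j))
  map_add' S T := by
    change inner ℂ (e i) ((S : H →L[ℂ] H) (e j) + (T : H →L[ℂ] H) (e j)) = _
    rw [inner_add_right]
  map_smul' r T := by
    change inner ℂ (e i) (r • (T : H →L[ℂ] H) (e j)) = _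
    rw [inner_smul_right]; rfl

theorem matrixEntry_apply (i j : ι) (T : compactOperators H) :
    matrixEntry e i j T = inner ℂ (e i) ((T : H →L[ℂ] H) (e j)) := rfl

theorem norm_matrixEntry_le (i j : ι) (T : compactOperators H) : ‖matrixEntry e i j T‖ ≤ ‖T‖ := by
  rw [matrixEntry_apply]
  refine (norm_inner_le_norm _ _).trans ?_
  have h := (T : H →L[ℂ] H).le_opNorm (e j)
  rw [e.orthonormal.1, mul_one] at h
  rw [e.orthonormal.1, one_mul]
  exact h

theorem matrixEntry_matrixUnit [DecidableEq ι] (i j k l : ι) :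
    matrixEntry e i j (matrixUnit e k l) = if i = k ∧ l = j then 1 else 0 := by
  rw [matrixEntry_apply, coe_matrixUnit, rankOne_apply, inner_smul_right, inner_basis, inner_basis]
  split_ifs <;> simp_all

theorem exists_norm_sub_sum_matrixUnit_lt (T : compactOperators H) {ε : ℝ} (hε : 0 < ε) :
    ∃ S : Finset ι, ‖T - ∑ i ∈ S, ∑ j ∈ S, matrixEntry e i j T • matrixUnit e i j‖ < ε := by
  have hT : IsCompactOperator (T : H →L[ℂ] H) := T.2
  have hT' := isCompactOperator_star hT
  have h3 : 0 < ε / 3 := by positivity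
  -- With P the projection, the condition on T* becomes ‖T − TP‖ ≤ ε/3 after taking adjoints. The
  -- two estimates then combine through T − PTP = (T − PT) + P(T − TP).
  obtain ⟨S, hS, hS'⟩ := ((eventually_norm_sub_basisProj_mul e hT h3).and
    (eventually_norm_sub_basisProj_mul e hT' h3)).exists
  refine ⟨S, ?_⟩
  rw [← norm_star, star_sub, star_star, star_mul, star_star, star_basisProj] at hS'
  have e1 : ((∑ i ∈ S, ∑ j ∈ S, matrixEntry e i j T • matrixUnit e i j : compactOperators H) :
      H →L[ℂ] H) = basisProj e S * T * basisProj e S := by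
    rw [basisProj, Finset.sum_mul, Finset.sum_mul_sum]
    push_cast
    refine Finset.sum_congr rfl fun i _ => Finset.sum_congr rfl fun j _ => ?_
    ext x
    simp only [matrixEntry_apply, coe_matrixUnit, smul_apply, rankOne_apply,
      mul_apply_eq_comp, map_smul, smul_smul]
    rw [mul_comm]
  have e2 : (T : H →L[ℂ] H) - basisProj e S * T * basisProj e S =
      (T - basisProj e S * T) + basisProj e S * (T - T * basisProj e S) := by
    rw [mul_sub, mul_assoc]; abel
  change ‖(T : H →L[ℂ] H) - ((∑ i ∈ S, ∑ j ∈ S, matrixEntry e i j T • matrixUnit e i j :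
    compactOperators H) : H →L[ℂ] H)‖ < ε
  rw [e1, e2]
  have h4 := norm_mul_le (basisProj e S) ((T : H →L[ℂ] H) - T * basisProj e S)
  have h5 := mul_le_mul_of_nonneg_right (norm_basisProj_le e S)
    (norm_nonneg ((T : H →L[ℂ] H) - T * basisProj e S))
  refine (norm_add_le _ _).trans_lt ?_
  linarith

end MatrixUnits

/-! ### The Fourier basis -/

section FourierBasis

/-- The character `tᵐ` in `L²(𝕋)`. -/
def circleChar (m : ℤ) : L2Circle := ContinuousMap.toLp 2 circleHaar ℂ (trigMonomial m 1)

theorem orthonormal_circleChar : Orthonormal ℂ circleChar := by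
  classical
  rw [orthonormal_iff_ite]
  intro i j
  rw [circleChar, circleChar, ContinuousMap.inner_toLp]
  have h : ∀ t : Circle, trigMonomial j (1 : ℂ) t * (starRingEnd ℂ) (trigMonomial i (1 : ℂ) t) =
      ((t ^ (j - i) : Circle) : ℂ) • (1 : ℂ) := fun t => by
    rw [trigMonomial_apply, trigMonomial_apply, smul_eq_mul, smul_eq_mul, mul_one, mul_one,
      ← Circle.coe_inv_eq_conj, ← Circle.coe_mul, zpow_sub, smul_eq_mul, mul_one]
  simp only [h, integral_zpow_smul, sub_eq_zero, eq_comm]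

/-- The Hilbert basis of `L²(𝕋)` that consists of the characters. -/
def circleBasis : HilbertBasis ℤ ℂ L2Circle :=
  HilbertBasis.mk orthonormal_circleChar (by
    -- Uniform density of the characters' span in C(𝕋) passes to L², where C(𝕋) is dense.
    have h := (ContinuousMap.toLp_denseRange ℂ circleHaar ℂ
      (p := 2) (by norm_num)).topologicalClosure_map_submodule
      (s := Submodule.span ℂ (Set.range fun m : ℤ => trigMonomial m (1 : ℂ)))
      (eq_top_iff.mpr fun f _ => mem_closure_span_trigMonomial_complex f)
    rw [Submodule.map_span, ← Set.range_comp] at h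
    exact h.ge)

end FourierBasis

/-! ### The projective tensor norm -/

section ProjectiveNorm

variable {A B : Type*} [NonUnitalCStarAlgebra A] [NonUnitalCStarAlgebra B]

theorem projectiveNorm_list_le (l : List (A × B)) :
    projectiveNorm A B (l.map fun x => x.1 ⊗ₜ[ℂ] x.2).sum ≤
      (l.map fun x => ‖x.1‖ * ‖x.2‖).sum := by
  refine csInf_le ⟨0, ?_⟩ ⟨l, rfl, rfl⟩
  rintro _ ⟨m, -, rfl⟩
  refine List.sum_nonneg fun r hr => ?_
  obtain ⟨x, -, rfl⟩ := List.mem_map.mp hr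
  positivity

theorem exists_list_tmul (t : A ⊗[ℂ] B) :
    ∃ l : List (A × B), (l.map fun x => x.1 ⊗ₜ[ℂ] x.2).sum = t := by
  induction t using TensorProduct.induction_on with
  | zero => exact ⟨[], rfl⟩
  | tmul a c => exact ⟨[(a, c)], by simp⟩
  | add x y hx hy =>
    obtain ⟨l, rfl⟩ := hx
    obtain ⟨m, rfl⟩ := hy
    exact ⟨l ++ m, by simp⟩

theorem le_projectiveNorm {t : A ⊗[ℂ] B} {r : ℝ}
    (h : ∀ l : List (A × B), (l.map fun x => x.1 ⊗ₜ[ℂ] x.2).sum = t →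
      r ≤ (l.map fun x => ‖x.1‖ * ‖x.2‖).sum) : r ≤ projectiveNorm A B t := by
  obtain ⟨l, hl⟩ := exists_list_tmul t
  refine le_csInf ⟨_, l, hl, rfl⟩ ?_
  rintro _ ⟨m, hm, rfl⟩
  exact h m hm

theorem exists_list_lt_projectiveNorm_add (t : A ⊗[ℂ] B) {ε : ℝ} (hε : 0 < ε) :
    ∃ l : List (A × B), (l.map fun x => x.1 ⊗ₜ[ℂ] x.2).sum = t ∧
      (l.map fun x => ‖x.1‖ * ‖x.2‖).sum < projectiveNorm A B t + ε := by
  obtain ⟨l, hl⟩ := exists_list_tmul t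
  have hne : {r | ∃ l : List (A × B), (l.map fun x => x.1 ⊗ₜ[ℂ] x.2).sum = t ∧
      (l.map fun x => ‖x.1‖ * ‖x.2‖).sum = r}.Nonempty := ⟨_, l, hl, rfl⟩
  obtain ⟨_, ⟨m, hm, rfl⟩, hlt⟩ := exists_lt_of_csInf_lt hne
    (lt_add_of_pos_right (projectiveNorm A B t) hε)
  exact ⟨m, hm, hlt⟩

theorem projectiveNorm_nonneg (t : A ⊗[ℂ] B) : 0 ≤ projectiveNorm A B t := by
  refine le_projectiveNorm fun l _ => List.sum_nonneg fun r hr => ?_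
  obtain ⟨x, -, rfl⟩ := List.mem_map.mp hr
  positivity

theorem projectiveNorm_tmul_le (a : A) (b : B) : projectiveNorm A B (a ⊗ₜ b) ≤ ‖a‖ * ‖b‖ := by
  simpa using projectiveNorm_list_le [(a, b)]

theorem projectiveNorm_add_le (s t : A ⊗[ℂ] B) :
    projectiveNorm A B (s + t) ≤ projectiveNorm A B s + projectiveNorm A B t := by
  refine le_of_forall_pos_le_add fun ε hε => ?_
  obtain ⟨l, rfl, hl⟩ := exists_list_lt_projectiveNorm_add s (half_pos hε)
  obtain ⟨m, rfl, hm⟩ := exists_list_lt_projectiveNorm_add t (half_pos hε)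
  have h := projectiveNorm_list_le (l ++ m)
  rw [List.map_append, List.map_append, List.sum_append, List.sum_append] at h
  linarith

theorem projectiveNorm_smul_le (r : ℂ) (t : A ⊗[ℂ] B) :
    projectiveNorm A B (r • t) ≤ ‖r‖ * projectiveNorm A B t := by
  refine le_of_forall_pos_le_add fun ε hε => ?_
  -- The denominator ‖r‖ + 1 in place of ‖r‖ also covers r = 0.
  obtain ⟨l, rfl, hl⟩ := exists_list_lt_projectiveNorm_add t
    (show 0 < ε / (‖r‖ + 1) by positivity)
  have h := projectiveNorm_list_le (l.map fun x => (r • x.1, x.2))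
  have e1 : ((l.map fun x => (r • x.1, x.2)).map fun x => x.1 ⊗ₜ[ℂ] x.2).sum =
      r • (l.map fun x => x.1 ⊗ₜ[ℂ] x.2).sum := by
    rw [List.map_map, List.smul_sum, List.map_map]
    rfl
  have e2 : ((l.map fun x => (r • x.1, x.2)).map fun x => ‖x.1‖ * ‖x.2‖).sum =
      ‖r‖ * (l.map fun x => ‖x.1‖ * ‖x.2‖).sum := by
    rw [List.map_map, ← List.sum_map_mul_left]
    congr 1
    refine List.map_congr_left fun x _ => ?_
    simp [norm_smul, mul_assoc]
  rw [e1, e2] at h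
  refine h.trans ((mul_le_mul_of_nonneg_left hl.le (norm_nonneg r)).trans ?_)
  rw [mul_add]
  have : ‖r‖ * (ε / (‖r‖ + 1)) ≤ ε := by
    rw [mul_div_assoc', div_le_iff₀ (by positivity)]
    nlinarith [norm_nonneg r]
  linarith

theorem projectiveNorm_star_le (t : A ⊗[ℂ] B) :
    projectiveNorm A B (star t) ≤ projectiveNorm A B t := by
  refine le_projectiveNorm fun l hl => ?_
  subst hl
  have h := projectiveNorm_list_le (l.map fun x => (star x.1, star x.2))
  have e1 : ((l.map fun x => (star x.1, star x.2)).map fun x => x.1 ⊗ₜ[ℂ] x.2).sum =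
      star (l.map fun x => x.1 ⊗ₜ[ℂ] x.2).sum := by
    induction l with
    | nil => simp
    | cons x l ih => simpa using ih (projectiveNorm_list_le _)
  rw [e1, List.map_map] at h
  refine h.trans_eq ?_
  congr 1
  refine List.map_congr_left fun x _ => ?_
  simp

theorem projectiveNorm_mul_le (s t : A ⊗[ℂ] B) :
    projectiveNorm A B (s * t) ≤ projectiveNorm A B s * projectiveNorm A B t := by
  have key : ∀ l m : List (A × B), projectiveNorm A B
      ((l.map fun x => x.1 ⊗ₜ[ℂ] x.2).sum * (m.map fun x => x.1 ⊗ₜ[ℂ] x.2).sum) ≤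
      (l.map fun x => ‖x.1‖ * ‖x.2‖).sum * (m.map fun x => ‖x.1‖ * ‖x.2‖).sum := by
    intro l m
    have h1 : ∀ x : A × B, projectiveNorm A B
        (x.1 ⊗ₜ[ℂ] x.2 * (m.map fun x => x.1 ⊗ₜ[ℂ] x.2).sum) ≤
        (‖x.1‖ * ‖x.2‖) * (m.map fun x => ‖x.1‖ * ‖x.2‖).sum := by
      intro x
      induction m with
      | nil => simpa using projectiveNorm_list_le ([] : List (A × B))
      | cons y m ih =>
        simp only [List.map_cons, List.sum_cons, mul_add]
        refine (projectiveNorm_add_le _ _).trans (add_le_add ?_ ih)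
        rw [Algebra.TensorProduct.tmul_mul_tmul]
        refine (projectiveNorm_tmul_le _ _).trans ?_
        calc ‖x.1 * y.1‖ * ‖x.2 * y.2‖ ≤ (‖x.1‖ * ‖y.1‖) * (‖x.2‖ * ‖y.2‖) :=
              mul_le_mul (norm_mul_le _ _) (norm_mul_le _ _) (norm_nonneg _) (by positivity)
          _ = _ := by ring
    induction l with
    | nil => simpa using projectiveNorm_list_le ([] : List (A × B))
    | cons y l ih =>
      simp only [List.map_cons, List.sum_cons, add_mul]
      exact (projectiveNorm_add_le _ _).trans (add_le_add (h1 y) ih)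
  -- Representations of s and t are optimal only up to ε, so the bound is (‖s‖ + ε)(‖t‖ + ε) in
  -- projective norms, and ε tends to 0.
  have hlim : Filter.Tendsto (fun ε : ℝ => (projectiveNorm A B s + ε) * (projectiveNorm A B t + ε))
      (nhdsWithin 0 (Set.Ioi 0)) (nhds (projectiveNorm A B s * projectiveNorm A B t)) := by
    have : Continuous fun ε : ℝ => (projectiveNorm A B s + ε) * (projectiveNorm A B t + ε) := by
      fun_prop
    simpa using (this.tendsto 0).mono_left nhdsWithin_le_nhds
  refine ge_of_tendsto hlim ?_
  filter_upwards [self_mem_nhdsWithin] with ε hε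
  obtain ⟨l, hl, hl'⟩ := exists_list_lt_projectiveNorm_add s hε
  obtain ⟨m, hm, hm'⟩ := exists_list_lt_projectiveNorm_add t hε
  have h := key l m
  rw [hl, hm] at h
  refine h.trans (mul_le_mul hl'.le hm'.le ?_ ?_)
  · refine List.sum_nonneg fun r hr => ?_
    obtain ⟨x, -, rfl⟩ := List.mem_map.mp hr
    positivity
  · exact add_nonneg (projectiveNorm_nonneg s) (le_of_lt hε)

variable (A B) in
/-- The projective tensor norm as a seminorm. -/
def projectiveSeminorm : Seminorm ℂ (A ⊗[ℂ] B) :=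
  Seminorm.ofSMulLE (projectiveNorm A B)
    (le_antisymm (by simpa using projectiveNorm_list_le ([] : List (A × B)))
      (projectiveNorm_nonneg 0))
    projectiveNorm_add_le projectiveNorm_smul_le

theorem isStarAlgebraSeminorm_projectiveSeminorm :
    IsStarAlgebraSeminorm (projectiveSeminorm A B) where
  map_mul_le := projectiveNorm_mul_le
  map_star t := le_antisymm (projectiveNorm_star_le t)
    ((congrArg (projectiveNorm A B) (star_star t)).symm.trans_le (projectiveNorm_star_le (star t)))

/-- The slice map of a functional. -/
def slice (ψ : B →ₗ[ℂ] ℂ) : A ⊗[ℂ] B →ₗ[ℂ] A :=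
  (TensorProduct.rid ℂ A).toLinearMap ∘ₗ TensorProduct.map LinearMap.id ψ

theorem slice_tmul (ψ : B →ₗ[ℂ] ℂ) (a : A) (b : B) : slice ψ (a ⊗ₜ b) = ψ b • a := rfl

/-- The source of lower bounds for the projective norm: a slice by a contractive functional is
bounded term by term on every representation of t. Applied to matrix entries, it bounds the
coefficients of a finite matrix. -/
theorem norm_slice_le {ψ : B →ₗ[ℂ] ℂ} (hψ : ∀ b, ‖ψ b‖ ≤ ‖b‖) (t : A ⊗[ℂ] B) :
    ‖slice ψ t‖ ≤ projectiveNorm A B t := by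
  refine le_projectiveNorm fun l hl => ?_
  subst hl
  induction l with
  | nil => simp
  | cons x l ih =>
    simp only [List.map_cons, List.sum_cons, map_add, slice_tmul]
    refine (norm_add_le _ _).trans (add_le_add ?_ ih)
    rw [norm_smul, mul_comm]
    exact mul_le_mul_of_nonneg_left (hψ _) (norm_nonneg _)

/-- Approximating the second factor alone suffices, since the projective norm of a ⊗ (b − c) is at
most ‖a‖ ‖b − c‖. -/
theorem exists_mem_projectiveNorm_sub_lt {V : Submodule ℂ (A ⊗[ℂ] B)}
    (h : ∀ a b, ∀ ε > 0, ∃ c, a ⊗ₜ c ∈ V ∧ ‖b - c‖ < ε) (t : A ⊗[ℂ] B) :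
    ∀ ε > 0, ∃ s ∈ V, projectiveSeminorm A B (t - s) < ε := by
  induction t using TensorProduct.induction_on with
  | zero => exact fun ε hε => ⟨0, zero_mem _, by rwa [sub_zero, map_zero]⟩
  | tmul a b =>
    intro ε hε
    obtain ⟨c, hc, hbc⟩ := h a b (ε / (‖a‖ + 1)) (by positivity)
    refine ⟨_, hc, ?_⟩
    rw [← TensorProduct.tmul_sub]
    refine (projectiveNorm_tmul_le _ _).trans_lt ?_
    refine (mul_le_mul_of_nonneg_left hbc.le (norm_nonneg a)).trans_lt ?_
    rw [mul_div_assoc', div_lt_iff₀ (by positivity)]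
    nlinarith [norm_nonneg a]
  | add s t hs ht =>
    intro ε hε
    obtain ⟨v, hv, hv'⟩ := hs (ε / 2) (half_pos hε)
    obtain ⟨w, hw, hw'⟩ := ht (ε / 2) (half_pos hε)
    refine ⟨v + w, add_mem hv hw, ?_⟩
    rw [add_sub_add_comm]
    refine (map_add_le_add _ _ _).trans_lt ?_
    linarith

theorem projectiveNorm_sum_sum_le {ι : Type*} (S : Finset ι) {a : ι → ι → A} {b : ι → ι → B} {C : ℝ}
    (h : ∀ i ∈ S, ∀ j ∈ S, ‖a i j‖ * ‖b i j‖ ≤ C) :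
    projectiveNorm A B (∑ i ∈ S, ∑ j ∈ S, a i j ⊗ₜ b i j) ≤ (S.card * S.card : ℝ) * C :=
  seminorm_sum_sum_le (projectiveSeminorm A B) S fun i hi j hj =>
    (projectiveNorm_tmul_le _ _).trans (h i hi j hj)

end ProjectiveNorm

/-! ### The `L¹`-norm -/

namespace ConvAlgebra

variable {A : Type*} [CStarAlgebra A] {α : CircleAction A}

/-- Each α_s is isometric, so this is the scalar Young inequality: exchange the integrals and use
translation invariance. -/
theorem l1Norm_mul_le (f g : ConvAlgebra α) : l1Norm α (f * g) ≤ l1Norm α f * l1Norm α g := by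
  calc l1Norm α (f * g) ≤ ∫ t, (∫ s, ‖f s‖ * ‖g (s⁻¹ * t)‖ ∂circleHaar) ∂circleHaar := by
        refine integral_mono (integrable_circle (by fun_prop))
          (integrable_circle (continuous_circle_integral (by unfold Function.uncurry; fun_prop)))
          fun t => ?_
        refine norm_integral_le_of_norm_le (integrable_circle (by fun_prop)) (.of_forall fun s => ?_)
        refine (norm_mul_le _ _).trans_eq ?_
        rw [StarAlgEquiv.norm_map]
    _ = ∫ s, (∫ t, ‖f s‖ * ‖g (s⁻¹ * t)‖ ∂circleHaar) ∂circleHaar :=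
        integral_integral_swap (integrable_circle_prod (by unfold Function.uncurry; fun_prop))
    _ = ∫ s, ‖f s‖ * l1Norm α g ∂circleHaar := by
        congr 1 with s
        rw [integral_const_mul, integral_mul_left_eq_self (fun t => ‖g t‖)]
        rfl
    _ = l1Norm α f * l1Norm α g := integral_mul_const _ _

theorem l1Norm_star (f : ConvAlgebra α) : l1Norm α (star f) = l1Norm α f := by
  simp only [l1Norm, star_apply, StarAlgEquiv.norm_map, norm_star]
  exact integral_inv_eq_self (fun t => ‖f t‖) circleHaar

variable (α) in
/-- The `L¹`-norm as a seminorm. -/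
def l1Seminorm : Seminorm ℂ (ConvAlgebra α) :=
  Seminorm.of (l1Norm α)
    (fun f g => by
      rw [l1Norm, l1Norm, l1Norm, ← integral_add (integrable_circle (by fun_prop))
        (integrable_circle (by fun_prop))]
      exact integral_mono (integrable_circle (by fun_prop)) (integrable_circle (by fun_prop))
        fun t => norm_add_le _ _)
    (fun r f => by
      simp only [l1Norm, smul_apply, norm_smul]
      exact integral_const_mul _ _)

theorem isStarAlgebraSeminorm_l1Seminorm : IsStarAlgebraSeminorm (l1Seminorm α) where
  map_mul_le := l1Norm_mul_le
  map_star := l1Norm_star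

theorem l1Norm_le_of_norm_le {f : ConvAlgebra α} {C : ℝ} (h : ∀ t, ‖f t‖ ≤ C) :
    l1Norm α f ≤ C := by
  have := integral_mono (μ := circleHaar) (g := fun _ => C)
    (integrable_circle (f := fun t => ‖f t‖) (by fun_prop)) (integrable_const C) h
  rwa [integral_const, probReal_univ, one_smul] at this

end ConvAlgebra

/-! ### Matrix units in the convolution algebra -/

section UnitaryPowers

variable {A : Type*} [CStarAlgebra A] (u : unitary A)

/-- The integer powers of a unitary. -/
def unitaryZPow (n : ℤ) : A := ((u ^ n : unitary A) : A)

theorem unitaryZPow_mul (m n : ℤ) : unitaryZPow u m * unitaryZPow u n = unitaryZPow u (m + n) := by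
  rw [unitaryZPow, unitaryZPow, unitaryZPow, zpow_add]; rfl

theorem unitaryZPow_zero : unitaryZPow u 0 = 1 := by rw [unitaryZPow, zpow_zero]; rfl

theorem unitaryZPow_one : unitaryZPow u 1 = u := by rw [unitaryZPow, zpow_one]

theorem unitaryZPow_neg_mul_cancel (n : ℤ) (a : A) :
    unitaryZPow u (-n) * (unitaryZPow u n * a) = a := by
  rw [← mul_assoc, unitaryZPow_mul, neg_add_cancel, unitaryZPow_zero, one_mul]

theorem unitaryZPow_mul_neg_cancel (n : ℤ) (a : A) :
    unitaryZPow u n * (unitaryZPow u (-n) * a) = a := by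
  rw [← mul_assoc, unitaryZPow_mul, add_neg_cancel, unitaryZPow_zero, one_mul]

theorem star_unitaryZPow (n : ℤ) : star (unitaryZPow u n) = unitaryZPow u (-n) := by
  rw [unitaryZPow, unitaryZPow, zpow_neg, ← Unitary.star_eq_inv]; rfl

theorem norm_unitaryZPow_mul_mul (m n : ℤ) (a : A) :
    ‖unitaryZPow u m * a * unitaryZPow u n‖ = ‖a‖ := by
  rw [unitaryZPow, unitaryZPow, CStarRing.norm_mul_coe_unitary, CStarRing.norm_coe_unitary_mul]

theorem map_unitaryZPow {B : Type*} [CStarAlgebra B] (φ : A →⋆ₐ[ℂ] B) {v : unitary B}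
    (h : φ u = v) (n : ℤ) : φ (unitaryZPow u n) = unitaryZPow v n := by
  let ψ : A →⋆* B := ⟨(φ : A →* B), map_star φ⟩
  have hm : Unitary.map ψ u = v := Subtype.ext h
  rw [unitaryZPow, unitaryZPow, ← hm, ← map_zpow]
  rfl

end UnitaryPowers

namespace CircleAction

variable {A : Type*} [CStarAlgebra A] {α : CircleAction A}

theorem IsSpectral.mul {m n : ℤ} {a b : A} (ha : α.IsSpectral m a) (hb : α.IsSpectral n b) :
    α.IsSpectral (m + n) (a * b) := fun ζ => by
  rw [map_mul, ha, hb, smul_mul_smul_comm, ← Circle.coe_mul, zpow_add]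

theorem IsSpectral.star {m : ℤ} {a : A} (ha : α.IsSpectral m a) :
    α.IsSpectral (-m) (star a) := fun ζ => by
  rw [map_star, ha, star_smul, zpow_neg, Circle.coe_inv_eq_conj]; rfl

theorem mem_fixedPoints_iff {a : A} : a ∈ α.fixedPoints ↔ α.IsSpectral 0 a := by
  simp only [IsSpectral, zpow_zero, Circle.coe_one, one_smul]
  rfl

theorem isSpectral_unitaryZPow {u : unitary A} (hu : ∀ ζ : Circle, α ζ u = (ζ : ℂ) • (u : A))
    (n : ℤ) : α.IsSpectral n (unitaryZPow u n) := by
  have h1 : α.IsSpectral 1 (unitaryZPow u 1) := fun ζ => by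
    rw [unitaryZPow_one, hu, zpow_one]
  induction n with
  | zero => rw [unitaryZPow_zero]; exact mem_fixedPoints_iff.mp (one_mem _)
  | succ n ih => rw [← unitaryZPow_mul]; exact ih.mul h1
  | pred n ih =>
    rw [sub_eq_add_neg, ← unitaryZPow_mul]
    refine ih.mul ?_
    rw [← star_unitaryZPow]
    exact h1.star

variable (α) in
/-- The projection onto the `n`-th spectral subspace. -/
def spectralProj (n : ℤ) : A →ₗ[ℂ] A where
  toFun a := α.average (trigMonomial n a)
  map_add' a b := by
    rw [← average_add]
    congr 1
    ext t
    exact smul_add _ a b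
  map_smul' r a := by
    rw [RingHom.id_apply, ← average_smul]
    congr 1
    ext t
    exact smul_comm _ r a

theorem norm_spectralProj_le (n : ℤ) (a : A) : ‖α.spectralProj n a‖ ≤ ‖a‖ := by
  refine (α.norm_average_le _).trans ((ContinuousMap.norm_le _ (norm_nonneg a)).mpr fun t => ?_)
  rw [trigMonomial_apply, norm_smul, Circle.norm_coe, one_mul]

/-- The integrand is s^(n−m) a, so orthogonality of characters decides the value. -/
theorem IsSpectral.spectralProj_apply {m : ℤ} {a : A} (ha : α.IsSpectral m a) (n : ℤ) :
    α.spectralProj n a = if m = n then a else 0 := by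
  have h : ∀ s : Circle, α s⁻¹ (trigMonomial n a s) = ((s ^ (n - m) : Circle) : ℂ) • a := by
    intro s
    rw [trigMonomial_apply, map_smul, ha, smul_smul, ← Circle.coe_mul, inv_zpow', zpow_sub,
      zpow_neg]
  change ∫ s : Circle, α s⁻¹ (trigMonomial n a s) ∂circleHaar = _
  simp only [h, integral_zpow_smul, sub_eq_zero, eq_comm]

end CircleAction

/-- An embedding of a C*-algebra `D` onto the fixed point algebra. -/
structure IsFixedPointEmbedding {A D : Type*} [CStarAlgebra A] [NonUnitalCStarAlgebra D]
    (α : CircleAction A) (κ : D →⋆ₙₐ[ℂ] A) : Prop where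
  norm_map : ∀ d, ‖κ d‖ = ‖d‖
  isSpectral : ∀ d, α.IsSpectral 0 (κ d)
  exists_eq : ∀ a, α.IsSpectral 0 a → ∃ d, κ d = a

namespace ConvAlgebra

variable {A D : Type*} [CStarAlgebra A] [NonUnitalCStarAlgebra D] (α : CircleAction A)
  (u : unitary A) (κ : D →⋆ₙₐ[ℂ] A)

/-- The element `t ↦ tʲ u⁻ⁱ d uʲ` of the convolution algebra. -/
def convUnit (i j : ℤ) : D →ₗ[ℂ] ConvAlgebra α where
  toFun d := (trigMonomial j (unitaryZPow u (-i) * κ d * unitaryZPow u j) : C(Circle, A))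
  map_add' c d := by
    ext t
    change trigMonomial j (unitaryZPow u (-i) * κ (c + d) * unitaryZPow u j) t =
      trigMonomial j (unitaryZPow u (-i) * κ c * unitaryZPow u j) t +
        trigMonomial j (unitaryZPow u (-i) * κ d * unitaryZPow u j) t
    simp only [trigMonomial_apply, map_add, mul_add, add_mul, smul_add]
  map_smul' r d := by
    ext t
    change trigMonomial j (unitaryZPow u (-i) * κ (r • d) * unitaryZPow u j) t =
      r • trigMonomial j (unitaryZPow u (-i) * κ d * unitaryZPow u j) t
    simp only [trigMonomial_apply, map_smul, mul_smul_comm, smul_mul_assoc]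
    rw [smul_comm]

theorem convUnit_apply (i j : ℤ) (d : D) (t : Circle) :
    convUnit α u κ i j d t =
      ((t ^ j : Circle) : ℂ) • (unitaryZPow u (-i) * κ d * unitaryZPow u j) := rfl

variable {α κ}

theorem l1Norm_convUnit_le (hκ : IsFixedPointEmbedding α κ) (i j : ℤ) (d : D) :
    l1Norm α (convUnit α u κ i j d) ≤ ‖d‖ :=
  l1Norm_le_of_norm_le fun t => by
    rw [convUnit_apply, norm_smul, Circle.norm_coe, one_mul, norm_unitaryZPow_mul_mul, hκ.norm_map]

variable {u}

theorem isSpectral_unitaryZPow_mul_mul (hκ : IsFixedPointEmbedding α κ)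
    (hu : ∀ ζ : Circle, α ζ u = (ζ : ℂ) • (u : A)) (i j : ℤ)
    (d : D) :
    α.IsSpectral (j - i) (unitaryZPow u (-i) * κ d * unitaryZPow u j) := by
  have := ((CircleAction.isSpectral_unitaryZPow hu (-i)).mul
    (hκ.isSpectral d)).mul (CircleAction.isSpectral_unitaryZPow hu j)
  rwa [add_zero, neg_add_eq_sub] at this

/-- The powers of s in the integrand are sʲ from the first factor, s⁻ˡ from the argument s⁻¹t, and
s^(l−k) from α_s acting on a coefficient of degree l − k. Their product is s^(j−k), so the integral
vanishes unless j = k, and then uʲ u⁻ᵏ cancels in the middle. -/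
theorem convUnit_mul (hκ : IsFixedPointEmbedding α κ)
    (hu : ∀ ζ : Circle, α ζ u = (ζ : ℂ) • (u : A)) (i j k l : ℤ)
    (c d : D) :
    convUnit α u κ i j c * convUnit α u κ k l d = if j = k then convUnit α u κ i l (c * d) else 0 := by
  ext t
  set a := unitaryZPow u (-i) * κ c * unitaryZPow u j with ha
  set b := unitaryZPow u (-k) * κ d * unitaryZPow u l with hb
  have hgrp : ∀ x y z w : Circle, x * (y⁻¹ * z) * (y * w⁻¹) = x * w⁻¹ * z := fun x y z w => by
    rw [mul_mul_mul_comm, mul_assoc x y, mul_assoc y⁻¹, mul_inv_cancel_left, mul_comm z, mul_assoc]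
  have h : ∀ s : Circle, convUnit α u κ i j c s * α s (convUnit α u κ k l d (s⁻¹ * t)) =
      ((s ^ (j - k) : Circle) : ℂ) • ((t ^ l : Circle) : ℂ) • (a * b) := by
    intro s
    rw [convUnit_apply, convUnit_apply, ← ha, ← hb, map_smul,
      isSpectral_unitaryZPow_mul_mul hκ hu k l d s, smul_mul_assoc, mul_smul_comm, mul_smul_comm,
      smul_smul, smul_smul, smul_smul, ← Circle.coe_mul, ← Circle.coe_mul, ← Circle.coe_mul]
    congr 2
    rw [mul_zpow, inv_zpow, zpow_sub, zpow_sub]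
    exact hgrp _ _ _ _
  rw [mul_apply]
  simp only [h, integral_zpow_smul, sub_eq_zero]
  split_ifs with hjk
  · subst hjk
    rw [convUnit_apply, ha, hb]
    congr 1
    simp only [mul_assoc, unitaryZPow_mul_neg_cancel, map_mul]
  · rfl

/-- The conjugate of t⁻ʲ gives tʲ, and α_t acts on the adjoint coefficient, of degree i − j, by
t^(i−j). Together they give tⁱ. -/
theorem star_convUnit (hκ : IsFixedPointEmbedding α κ)
    (hu : ∀ ζ : Circle, α ζ u = (ζ : ℂ) • (u : A)) (i j : ℤ)
    (d : D) : star (convUnit α u κ i j d) = convUnit α u κ j i (star d) := by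
  ext t
  have h := (isSpectral_unitaryZPow_mul_mul hκ hu i j d).star t
  rw [star_apply, convUnit_apply, convUnit_apply, star_smul, map_smul, h, smul_smul]
  have e1 : star (((t⁻¹ ^ j : Circle) : ℂ)) = ((t ^ j : Circle) : ℂ) := by
    rw [inv_zpow, Circle.coe_inv_eq_conj]
    exact star_star _
  rw [e1, ← Circle.coe_mul, ← zpow_add, star_mul, star_mul, star_unitaryZPow, star_unitaryZPow,
    neg_neg, map_star κ, mul_assoc]
  congr 3
  ring

variable (α) in
/-- The Fourier coefficients of an element of the convolution algebra. -/
def convFourierCoeff (j : ℤ) : ConvAlgebra α →ₗ[ℂ] A where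
  toFun f := ∫ t, ((t ^ (-j) : Circle) : ℂ) • f t ∂circleHaar
  map_add' f g := by
    simp only [add_apply, smul_add]
    exact integral_add (integrable_circle (trig_smul f)) (integrable_circle (trig_smul g))
  map_smul' r f := by
    simp only [smul_apply, smul_comm _ r]
    exact integral_smul _ _
where
  trig_smul (f : ConvAlgebra α) : Continuous fun t => ((t ^ (-j) : Circle) : ℂ) • f t :=
    ((continuous_subtype_val.comp (continuous_zpow (-j)) :
      Continuous fun t : Circle => ((t ^ (-j) : Circle) : ℂ))).smul (map_continuous f)

theorem norm_convFourierCoeff_le (j : ℤ) (f : ConvAlgebra α) :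
    ‖convFourierCoeff α j f‖ ≤ l1Norm α f := by
  refine (norm_integral_le_integral_norm _).trans_eq ?_
  simp only [norm_smul, Circle.norm_coe, one_mul]
  rfl

variable (α) in
/-- The matrix entries of an element of the convolution algebra. -/
def convEntry (i j : ℤ) : ConvAlgebra α →ₗ[ℂ] A := α.spectralProj (j - i) ∘ₗ convFourierCoeff α j

theorem norm_convEntry_le (i j : ℤ) (f : ConvAlgebra α) : ‖convEntry α i j f‖ ≤ l1Norm α f :=
  (CircleAction.norm_spectralProj_le _ _).trans (norm_convFourierCoeff_le j f)

/-- The j-th Fourier coefficient forces l = j. The remaining coefficient has spectral degree j − k,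
and the projection to degree j − i forces k = i. -/
theorem convEntry_convUnit (hκ : IsFixedPointEmbedding α κ)
    (hu : ∀ ζ : Circle, α ζ u = (ζ : ℂ) • (u : A)) (i j k l : ℤ)
    (d : D) : convEntry α i j (convUnit α u κ k l d) =
      if i = k ∧ l = j then unitaryZPow u (-i) * κ d * unitaryZPow u j else 0 := by
  have h1 : convFourierCoeff α j (convUnit α u κ k l d) =
      if l = j then unitaryZPow u (-k) * κ d * unitaryZPow u l else 0 := by
    change ∫ t, ((t ^ (-j) : Circle) : ℂ) • convUnit α u κ k l d t ∂circleHaar = _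
    simp only [convUnit_apply, smul_smul, ← Circle.coe_mul, ← zpow_add, integral_zpow_smul,
      neg_add_eq_zero, eq_comm]
  rw [convEntry, LinearMap.comp_apply, h1]
  by_cases hl : l = j
  · subst hl
    rw [if_pos rfl, (isSpectral_unitaryZPow_mul_mul hκ hu k l d).spectralProj_apply]
    by_cases hk : i = k
    · subst hk; simp
    · rw [if_neg (by simpa using Ne.symm hk), if_neg (by simp [hk])]
  · rw [if_neg hl, map_zero, if_neg (by simp [hl])]

/-- Trigonometric polynomials are uniformly dense, their coefficients can be approximated by sums of
spectral elements, and the uniform norm dominates the L¹-norm. -/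
theorem exists_mem_span_convUnit (hκ : IsFixedPointEmbedding α κ)
    (hu : ∀ ζ : Circle, α ζ u = (ζ : ℂ) • (u : A))
    (f : ConvAlgebra α) {ε : ℝ} (hε : 0 < ε) :
    ∃ g ∈ Submodule.span ℂ {g | ∃ i j d, g = convUnit α u κ i j d}, l1Norm α (f - g) < ε := by
  let V : Submodule ℂ C(Circle, A) := Submodule.span ℂ {g | ∃ i j d, g = convUnit α u κ i j d}
  have hmono : ∀ m a, trigMonomial m a ∈ V.topologicalClosure := by
    intro m a
    let L : A →L[ℂ] C(Circle, A) := LinearMap.mkContinuous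
      ⟨⟨fun a => trigMonomial m a, fun a b => by ext t; exact smul_add _ a b⟩,
        fun r a => by ext t; exact smul_comm _ r a⟩ 1 fun a => by
          rw [one_mul]
          refine (ContinuousMap.norm_le _ (norm_nonneg a)).mpr fun t => ?_
          change ‖((t ^ m : Circle) : ℂ) • a‖ ≤ ‖a‖
          rw [norm_smul, Circle.norm_coe, one_mul]
    have hL : ∀ b, trigMonomial m b = L b := fun _ => rfl
    refine map_mem_closure L.continuous (α.mem_closure_span_isSpectral a) fun b hb => ?_
    induction hb using Submodule.span_induction with
    | mem b hb =>
      obtain ⟨n, hn⟩ := hb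
      -- For b of degree n, the monomial tᵐ b is E_ij(d) with i = m − n, j = m and d = u^(m−n) b
      -- u^(−m), whose degree is (m − n) + n − m = 0.
      have hd : α.IsSpectral 0 (unitaryZPow u (m - n) * b * unitaryZPow u (-m)) := by
        have := ((CircleAction.isSpectral_unitaryZPow hu (m - n)).mul hn).mul
          (CircleAction.isSpectral_unitaryZPow hu (-m))
        rwa [sub_add_cancel, add_neg_cancel] at this
      obtain ⟨d, hd⟩ := hκ.exists_eq _ hd
      refine Submodule.subset_span ⟨m - n, m, d, ?_⟩
      ext t
      change ((t ^ m : Circle) : ℂ) • b = ((t ^ m : Circle) : ℂ) • _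
      rw [hd]
      congr 1
      simp only [mul_assoc, unitaryZPow_neg_mul_cancel, unitaryZPow_mul, neg_add_cancel,
        unitaryZPow_zero, mul_one]
    | zero => rw [hL, map_zero]; exact Submodule.zero_mem _
    | add x y _ _ hx hy => rw [hL, map_add]; exact Submodule.add_mem _ hx hy
    | smul r x _ hx => rw [hL, map_smul]; exact Submodule.smul_mem _ r hx
  have hspan : Submodule.span ℂ {g : C(Circle, A) | ∃ m b, g = trigMonomial m b} ≤
      V.topologicalClosure := by
    rw [Submodule.span_le]
    rintro _ ⟨m, b, rfl⟩
    exact hmono m b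
  have hf : f ∈ closure (V : Set C(Circle, A)) :=
    closure_minimal hspan (Submodule.isClosed_topologicalClosure V)
      (mem_closure_span_trigMonomial f)
  obtain ⟨g, hg, hfg⟩ := Metric.mem_closure_iff.mp hf ε hε
  refine ⟨g, hg, lt_of_le_of_lt (l1Norm_le_of_norm_le fun t => ?_) hfg⟩
  refine (dist_eq_norm _ _).symm.trans_le ?_
  exact ContinuousMap.dist_apply_le_dist (f := (f : C(Circle, A))) (g := g) t

end ConvAlgebra

/-! ### The isomorphism of the crossed product with the stabilized fixed point algebra -/

section Stabilization

variable {A D H : Type*} [CStarAlgebra A] [NonUnitalCStarAlgebra D] [NormedAddCommGroup H]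
  [InnerProductSpace ℂ H] [CompleteSpace H] (α : CircleAction A) (u : unitary A)
  (κ : D →⋆ₙₐ[ℂ] A) (e : HilbertBasis ℤ ℂ H)

/-- The pair of corresponding matrix units of the convolution algebra and the tensor product. -/
def pairUnit (i j : ℤ) : D →ₗ[ℂ] ConvAlgebra α × (D ⊗[ℂ] compactOperators H) :=
  (ConvAlgebra.convUnit α u κ i j).prod
    ((TensorProduct.mk ℂ D (compactOperators H)).flip (matrixUnit e i j))

theorem pairUnit_apply (i j : ℤ) (d : D) : pairUnit α u κ e i j d =
    (ConvAlgebra.convUnit α u κ i j d, d ⊗ₜ matrixUnit e i j) := rfl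

/-- The set of pairs of corresponding matrix units with indices in `S`. -/
def pairUnits (S : Set ℤ) : Set (ConvAlgebra α × (D ⊗[ℂ] compactOperators H)) :=
  {x | ∃ i ∈ S, ∃ j ∈ S, ∃ d, x = pairUnit α u κ e i j d}

variable {α u κ e}

theorem pairUnit_mul (hκ : IsFixedPointEmbedding α κ)
    (hu : ∀ ζ : Circle, α ζ u = (ζ : ℂ) • (u : A)) (i j k l : ℤ)
    (c d : D) :
    pairUnit α u κ e i j c * pairUnit α u κ e k l d = if j = k then pairUnit α u κ e i l (c * d) else 0 := by
  rw [pairUnit_apply, pairUnit_apply, Prod.mk_mul_mk, ConvAlgebra.convUnit_mul hκ hu,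
    Algebra.TensorProduct.tmul_mul_tmul, matrixUnit_mul_matrixUnit]
  split_ifs
  · rfl
  · rw [TensorProduct.tmul_zero]; rfl

theorem star_pairUnit (hκ : IsFixedPointEmbedding α κ)
    (hu : ∀ ζ : Circle, α ζ u = (ζ : ℂ) • (u : A)) (i j : ℤ)
    (d : D) : star (pairUnit α u κ e i j d) = pairUnit α u κ e j i (star d) := by
  rw [pairUnit_apply, pairUnit_apply, Prod.star_def]
  simp only
  rw [ConvAlgebra.star_convUnit hκ hu, TensorProduct.star_tmul, star_matrixUnit]

variable (e) in
/-- The *-algebra of pairs of corresponding finite matrices with indices in `S`. -/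
def pairAlgebra (hκ : IsFixedPointEmbedding α κ)
    (hu : ∀ ζ : Circle, α ζ u = (ζ : ℂ) • (u : A)) (S : Set ℤ) :
    NonUnitalStarSubalgebra ℂ (ConvAlgebra α × (D ⊗[ℂ] compactOperators H)) :=
  { Submodule.span ℂ (pairUnits α u κ e S) with
    mul_mem' := fun {x y} hx hy => by
      change x * y ∈ Submodule.span ℂ (pairUnits α u κ e S)
      change x ∈ Submodule.span ℂ (pairUnits α u κ e S) at hx
      change y ∈ Submodule.span ℂ (pairUnits α u κ e S) at hy
      induction hx using Submodule.span_induction with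
      | mem x hx =>
        obtain ⟨i, hi, j, hj, c, rfl⟩ := hx
        induction hy using Submodule.span_induction with
        | mem y hy =>
          obtain ⟨k, hk, l, hl, d, rfl⟩ := hy
          rw [pairUnit_mul hκ hu]
          split_ifs
          · exact Submodule.subset_span ⟨i, hi, l, hl, _, rfl⟩
          · exact Submodule.zero_mem _
        | zero => rw [mul_zero]; exact Submodule.zero_mem _
        | add y z _ _ hy hz => rw [mul_add]; exact Submodule.add_mem _ hy hz
        | smul r y _ hy => rw [mul_smul_comm]; exact Submodule.smul_mem _ r hy
      | zero => rw [zero_mul]; exact Submodule.zero_mem _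
      | add x z _ _ hx hz => rw [add_mul]; exact Submodule.add_mem _ hx hz
      | smul r x _ hx => rw [smul_mul_assoc]; exact Submodule.smul_mem _ r hx
    star_mem' := fun {x} hx => by
      change star x ∈ Submodule.span ℂ (pairUnits α u κ e S)
      change x ∈ Submodule.span ℂ (pairUnits α u κ e S) at hx
      induction hx using Submodule.span_induction with
      | mem x hx =>
        obtain ⟨i, hi, j, hj, c, rfl⟩ := hx
        rw [star_pairUnit hκ hu]
        exact Submodule.subset_span ⟨j, hj, i, hi, _, rfl⟩
      | zero => rw [star_zero]; exact Submodule.zero_mem _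
      | add x z _ _ hx hz => rw [star_add]; exact Submodule.add_mem _ hx hz
      | smul r x _ hx => rw [star_smul]; exact Submodule.smul_mem _ _ hx }

theorem exists_finset_mem_span_pairUnits {x : ConvAlgebra α × (D ⊗[ℂ] compactOperators H)}
    (hx : x ∈ Submodule.span ℂ (pairUnits α u κ e Set.univ)) :
    ∃ S : Finset ℤ, x ∈ Submodule.span ℂ (pairUnits α u κ e S) := by
  have hmono : ∀ {S T : Finset ℤ}, S ⊆ T →
      Submodule.span ℂ (pairUnits α u κ e S) ≤ Submodule.span ℂ (pairUnits α u κ e T) := fun h =>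
    Submodule.span_mono (by rintro _ ⟨i, hi, j, hj, d, rfl⟩; exact ⟨i, h hi, j, h hj, d, rfl⟩)
  induction hx using Submodule.span_induction with
  | mem x hx =>
    obtain ⟨i, -, j, -, d, rfl⟩ := hx
    exact ⟨{i, j}, Submodule.subset_span ⟨i, by simp, j, by simp, d, rfl⟩⟩
  | zero => exact ⟨∅, Submodule.zero_mem _⟩
  | add x y _ _ hx hy =>
    obtain ⟨S, hS⟩ := hx
    obtain ⟨T, hT⟩ := hy
    exact ⟨S ∪ T, Submodule.add_mem _ (hmono Finset.subset_union_left hS)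
      (hmono Finset.subset_union_right hT)⟩
  | smul r x _ hx =>
    obtain ⟨S, hS⟩ := hx
    exact ⟨S, Submodule.smul_mem _ r hS⟩

theorem exists_eq_sum_pairUnit {S : Finset ℤ} {x : ConvAlgebra α × (D ⊗[ℂ] compactOperators H)}
    (hx : x ∈ Submodule.span ℂ (pairUnits α u κ e S)) :
    ∃ d : ℤ → ℤ → D, x = ∑ i ∈ S, ∑ j ∈ S, pairUnit α u κ e i j (d i j) := by
  induction hx using Submodule.span_induction with
  | mem x hx =>
    obtain ⟨i, hi, j, hj, d, rfl⟩ := hx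
    refine ⟨fun k l => if k = i then (if l = j then d else 0) else 0, ?_⟩
    rw [Finset.sum_eq_single_of_mem i hi fun k _ hk => by simp [hk],
      Finset.sum_eq_single_of_mem j hj fun l _ hl => by simp [hl]]
    simp
  | zero => exact ⟨0, by simp⟩
  | add x y _ _ hx hy =>
    obtain ⟨c, rfl⟩ := hx
    obtain ⟨d, rfl⟩ := hy
    exact ⟨c + d, by simp only [Pi.add_apply, map_add, Finset.sum_add_distrib]⟩
  | smul r x _ hx =>
    obtain ⟨c, rfl⟩ := hx
    exact ⟨r • c, by simp only [Pi.smul_apply, map_smul, Finset.smul_sum]⟩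

theorem sum_sum_ite_eq {M : Type*} [AddCommMonoid M] {S : Finset ℤ} {i j : ℤ} (hi : i ∈ S)
    (hj : j ∈ S) (f : ℤ → ℤ → M) :
    ∑ k ∈ S, ∑ l ∈ S, (if i = k ∧ l = j then f k l else 0) = f i j := by
  rw [Finset.sum_eq_single_of_mem i hi fun k _ hk =>
    Finset.sum_eq_zero fun l _ => if_neg fun h => hk h.1.symm,
    Finset.sum_eq_single_of_mem j hj fun l _ hl => if_neg fun h => hl h.2, if_pos ⟨rfl, rfl⟩]

/-- The contractive entry map recovers u⁻ⁱ κ(d_ij) uʲ, which has the norm of d_ij. -/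
theorem norm_coeff_le_l1Norm (hκ : IsFixedPointEmbedding α κ)
    (hu : ∀ ζ : Circle, α ζ u = (ζ : ℂ) • (u : A)) {S : Finset ℤ}
    (d : ℤ → ℤ → D) {i j : ℤ} (hi : i ∈ S) (hj : j ∈ S) :
    ‖d i j‖ ≤ ConvAlgebra.l1Norm α
      (∑ i ∈ S, ∑ j ∈ S, ConvAlgebra.convUnit α u κ i j (d i j)) := by
  refine le_trans (le_of_eq ?_) (ConvAlgebra.norm_convEntry_le i j _)
  simp only [map_sum, ConvAlgebra.convEntry_convUnit hκ hu]
  rw [sum_sum_ite_eq hi hj fun k l => unitaryZPow u (-i) * κ (d k l) * unitaryZPow u j,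
    norm_unitaryZPow_mul_mul, hκ.norm_map]

theorem norm_coeff_le_projectiveNorm {S : Finset ℤ}
    (d : ℤ → ℤ → D) {i j : ℤ} (hi : i ∈ S) (hj : j ∈ S) :
    ‖d i j‖ ≤ projectiveNorm D (compactOperators H)
      (∑ i ∈ S, ∑ j ∈ S, d i j ⊗ₜ matrixUnit e i j) := by
  refine le_trans (le_of_eq ?_) (norm_slice_le (norm_matrixEntry_le e i j) _)
  simp only [map_sum, slice_tmul, matrixEntry_matrixUnit, ite_smul, one_smul, zero_smul]
  rw [sum_sum_ite_eq hi hj d]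

/-- Each of the |S|² matrix units has L¹-norm at most that of its coefficient, and each coefficient
is bounded by the projective norm through a slice map. -/
theorem l1Norm_le_mul_projectiveNorm (hκ : IsFixedPointEmbedding α κ) {S : Finset ℤ}
    {x : ConvAlgebra α × (D ⊗[ℂ] compactOperators H)} (hx : x ∈ Submodule.span ℂ (pairUnits α u κ e S)) :
    ConvAlgebra.l1Norm α x.1 ≤ (S.card * S.card : ℝ) *
      projectiveNorm D (compactOperators H) x.2 := by
  obtain ⟨d, rfl⟩ := exists_eq_sum_pairUnit hx
  simp only [Prod.fst_sum, Prod.snd_sum, pairUnit_apply]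
  exact seminorm_sum_sum_le (ConvAlgebra.l1Seminorm α) S fun i hi j hj =>
    (ConvAlgebra.l1Norm_convUnit_le u hκ i j (d i j)).trans (norm_coeff_le_projectiveNorm d hi hj)

theorem projectiveNorm_le_mul_l1Norm (hκ : IsFixedPointEmbedding α κ)
    (hu : ∀ ζ : Circle, α ζ u = (ζ : ℂ) • (u : A))
    {S : Finset ℤ} {x : ConvAlgebra α × (D ⊗[ℂ] compactOperators H)}
    (hx : x ∈ Submodule.span ℂ (pairUnits α u κ e S)) :
    projectiveNorm D (compactOperators H) x.2 ≤
      (S.card * S.card : ℝ) * ConvAlgebra.l1Norm α x.1 := by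
  obtain ⟨d, rfl⟩ := exists_eq_sum_pairUnit hx
  simp only [Prod.fst_sum, Prod.snd_sum, pairUnit_apply]
  refine projectiveNorm_sum_sum_le S fun i hi j hj => ?_
  rw [norm_matrixUnit, mul_one]
  exact norm_coeff_le_l1Norm hκ hu d hi hj

variable (hκ : IsFixedPointEmbedding α κ) (hu : ∀ ζ : Circle, α ζ u = (ζ : ℂ) • (u : A))

theorem exists_mem_pairAlgebra_l1Norm_sub_lt (f : ConvAlgebra α) (ε : ℝ) (hε : ε > 0) :
    ∃ z ∈ pairAlgebra e hκ hu Set.univ, ConvAlgebra.l1Seminorm α (f - z.1) < ε := by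
  obtain ⟨g, hg, hfg⟩ := ConvAlgebra.exists_mem_span_convUnit hκ hu f hε
  have : g ∈ (Submodule.span ℂ (pairUnits α u κ e Set.univ)).map
      (LinearMap.fst ℂ (ConvAlgebra α) (D ⊗[ℂ] compactOperators H)) := by
    rw [Submodule.map_span]
    refine Submodule.span_mono ?_ hg
    rintro _ ⟨i, j, d, rfl⟩
    exact ⟨_, ⟨i, trivial, j, trivial, d, rfl⟩, rfl⟩
  obtain ⟨x, hx, rfl⟩ := this
  exact ⟨x, hx, hfg⟩

theorem exists_mem_pairAlgebra_projectiveNorm_sub_lt (t : D ⊗[ℂ] compactOperators H) (ε : ℝ)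
    (hε : ε > 0) : ∃ z ∈ pairAlgebra e hκ hu Set.univ,
      projectiveSeminorm D (compactOperators H) (t - z.2) < ε := by
  obtain ⟨s, hs, hts⟩ := exists_mem_projectiveNorm_sub_lt (V := (Submodule.span ℂ
    (pairUnits α u κ e Set.univ)).map
      (LinearMap.snd ℂ (ConvAlgebra α) (D ⊗[ℂ] compactOperators H)))
    (fun d T ε hε => by
      obtain ⟨S, hS⟩ := exists_norm_sub_sum_matrixUnit_lt e T hε
      refine ⟨_, ?_, hS⟩
      rw [TensorProduct.tmul_sum]
      refine Submodule.sum_mem _ fun i _ => ?_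
      rw [TensorProduct.tmul_sum]
      refine Submodule.sum_mem _ fun j _ => ?_
      rw [TensorProduct.tmul_smul]
      exact Submodule.smul_mem _ _ ⟨pairUnit α u κ e i j d,
        Submodule.subset_span ⟨i, trivial, j, trivial, d, rfl⟩, rfl⟩) t ε hε
  obtain ⟨x, hx, rfl⟩ := hs
  exact ⟨x, hx, hts⟩

/-- An element of the span involves finitely many indices S, and all matrices over that block form a
*-algebra on which the constant |S|² serves both comparisons. -/
theorem exists_subalgebra_norm_le (z : ConvAlgebra α × (D ⊗[ℂ] compactOperators H))
    (hz : z ∈ pairAlgebra e hκ hu Set.univ) :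
    ∃ T : NonUnitalStarSubalgebra ℂ (ConvAlgebra α × (D ⊗[ℂ] compactOperators H)), z ∈ T ∧
      ∃ C : ℝ, ∀ x ∈ T,
        ConvAlgebra.l1Seminorm α x.1 ≤ C * projectiveSeminorm D (compactOperators H) x.2 ∧
        projectiveSeminorm D (compactOperators H) x.2 ≤ C * ConvAlgebra.l1Seminorm α x.1 := by
  obtain ⟨S, hS⟩ := exists_finset_mem_span_pairUnits hz
  exact ⟨pairAlgebra e hκ hu (S : Set ℤ), hS, S.card * S.card, fun x hx =>
    ⟨l1Norm_le_mul_projectiveNorm hκ hx, projectiveNorm_le_mul_l1Norm hκ hu hx⟩⟩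

variable (e) in
/-- The isomorphism `A ⋊_α 𝕋 ≃ A^α ⊗ 𝒦(H)` determined by a unitary `u` with `α_ζ(u) = ζ u` and
an orthonormal basis of `H`. It maps the matrix unit `t ↦ tʲ u⁻ⁱ d uʲ` to `d ⊗ eᵢⱼ`. -/
def stabilization : CrossedProduct α ≃⋆ₐ[ℂ] CStarTensor D (compactOperators H) :=
  -- The functions underlying these seminorms are `l1Norm` and `projectiveNorm` by definition, so
  -- the envelopes are the crossed product and the tensor product themselves.
  envelopeEquivOfPairs (b := ConvAlgebra.l1Seminorm α)
    (c := projectiveSeminorm D (compactOperators H))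
    ConvAlgebra.isStarAlgebraSeminorm_l1Seminorm isStarAlgebraSeminorm_projectiveSeminorm
    (V := pairAlgebra e hκ hu Set.univ) (exists_subalgebra_norm_le hκ hu)
    (exists_mem_pairAlgebra_l1Norm_sub_lt hκ hu)
    (exists_mem_pairAlgebra_projectiveNorm_sub_lt hκ hu)

theorem stabilization_of_convUnit (i j : ℤ) (d : D) :
    stabilization e hκ hu (CStarEnvelope.of _ (ConvAlgebra.convUnit α u κ i j d)) =
      CStarEnvelope.of _ (d ⊗ₜ matrixUnit e i j) :=
  envelopeEquivOfPairs_of (b := ConvAlgebra.l1Seminorm α)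
    (c := projectiveSeminorm D (compactOperators H))
    ConvAlgebra.isStarAlgebraSeminorm_l1Seminorm isStarAlgebraSeminorm_projectiveSeminorm
    (exists_subalgebra_norm_le hκ hu) (exists_mem_pairAlgebra_l1Norm_sub_lt hκ hu)
    (exists_mem_pairAlgebra_projectiveNorm_sub_lt hκ hu)
    (Submodule.subset_span ⟨i, trivial, j, trivial, d, rfl⟩ :
      pairUnit α u κ e i j d ∈ pairAlgebra e hκ hu Set.univ)

end Stabilization

/-! ### Naturality of the stabilization isomorphism -/

section Naturality

variable {A B D D' H : Type*} [CStarAlgebra A] [CStarAlgebra B] [NonUnitalCStarAlgebra D]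
  [NonUnitalCStarAlgebra D'] [NormedAddCommGroup H] [InnerProductSpace ℂ H] [CompleteSpace H]
  {α : CircleAction A} {β : CircleAction B} {u : unitary A} {v : unitary B}
  {κ : D →⋆ₙₐ[ℂ] A} {κ' : D' →⋆ₙₐ[ℂ] B}

/-- The hypothesis φ(u) = v enters here: it carries the powers of u in the matrix unit to those of
v. -/
theorem ConvAlgebra.map_convUnit (φ : A →⋆ₐ[ℂ] B) (hφ : α.IsEquivariant β φ) (huv : φ u = v)
    (ψ : D →⋆ₙₐ[ℂ] D') (hψ : ∀ d, κ' (ψ d) = φ (κ d)) (i j : ℤ) (d : D) :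
    ConvAlgebra.map φ hφ (ConvAlgebra.convUnit α u κ i j d) =
      ConvAlgebra.convUnit β v κ' i j (ψ d) := by
  ext t
  rw [map_apply, convUnit_apply, convUnit_apply, map_smul, map_mul, map_mul,
    map_unitaryZPow u φ huv, map_unitaryZPow u φ huv, hψ]

/-- Naturality of the isomorphism `A ⋊_α 𝕋 ≃ A^α ⊗ 𝒦(H)`. -/
theorem stabilization_map (e : HilbertBasis ℤ ℂ H) (hκ : IsFixedPointEmbedding α κ)
    (hκ' : IsFixedPointEmbedding β κ') (hu : ∀ ζ : Circle, α ζ u = (ζ : ℂ) • (u : A))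
    (hv : ∀ ζ : Circle, β ζ v = (ζ : ℂ) • (v : B)) (φ : A →⋆ₐ[ℂ] B)
    (hφ : α.IsEquivariant β φ) (huv : φ u = v) (ψ : D →⋆ₙₐ[ℂ] D')
    (hψ : ∀ d, κ' (ψ d) = φ (κ d)) (x : CrossedProduct α) :
    stabilization e hκ' hv (CrossedProduct.map φ hφ x) =
      CStarTensor.map (compactOperators H) ψ (stabilization e hκ hu x) := by
  let Φ : CrossedProduct α →⋆ₙₐ[ℂ] CStarTensor D' (compactOperators H) :=
    (stabilization e hκ' hv : CrossedProduct β →⋆ₙₐ[ℂ] CStarTensor D' (compactOperators H)).comp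
      (CrossedProduct.map φ hφ)
  let Φ' : CrossedProduct α →⋆ₙₐ[ℂ] CStarTensor D' (compactOperators H) :=
    (CStarTensor.map (compactOperators H) ψ).comp
      (stabilization e hκ hu : CrossedProduct α →⋆ₙₐ[ℂ] CStarTensor D (compactOperators H))
  -- Both composites are *-homomorphisms on the crossed product, so it suffices to compare them on
  -- the matrix units, whose span is L¹-dense.
  refine CStarEnvelope.hom_eq_of_span (b := ConvAlgebra.l1Seminorm α)
    (fun f _ hε => ConvAlgebra.exists_mem_span_convUnit hκ hu f hε) Φ Φ' ?_ x
  rintro _ ⟨i, j, d, rfl⟩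
  change stabilization e hκ' hv (CrossedProduct.map φ hφ (CStarEnvelope.of _ _)) =
    CStarTensor.map (compactOperators H) ψ (stabilization e hκ hu (CStarEnvelope.of _ _))
  have h1 : CrossedProduct.map φ hφ (CStarEnvelope.of _ (ConvAlgebra.convUnit α u κ i j d)) =
      CStarEnvelope.of _ (ConvAlgebra.map φ hφ (ConvAlgebra.convUnit α u κ i j d)) :=
    CStarEnvelope.map_of (ConvAlgebra.map φ hφ) (ConvAlgebra.l1Norm_map_le φ hφ) _
  have h2 : CStarTensor.map (compactOperators H) ψ (CStarEnvelope.of _ (d ⊗ₜ matrixUnit e i j)) =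
      CStarEnvelope.of _ (ψ d ⊗ₜ matrixUnit e i j) :=
    CStarEnvelope.map_of (algTensorMap (compactOperators H) ψ)
      (projectiveNorm_algTensorMap_le ψ) _
  rw [ConvAlgebra.map_convUnit φ hφ huv ψ hψ] at h1
  exact ((congrArg _ h1).trans (stabilization_of_convUnit hκ' hv i j (ψ d))).trans
    (h2.symm.trans (congrArg _ (stabilization_of_convUnit hκ hu i j d).symm))

end Naturality

/-! ### Exact eigenunitaries from the Rokhlin property -/

section Rokhlin

variable {A : Type*} [CStarAlgebra A] {α : CircleAction A}

/-- The inverse square root of `x* x`, for an invertible element `x`. -/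
theorem exists_cfc_inv_sqrt {x : A} (hx : IsUnit x) :
    ContinuousOn (fun r : ℝ => (Real.sqrt r)⁻¹) (spectrum ℝ (star x * x)) ∧
      cfc (fun r : ℝ => (Real.sqrt r)⁻¹) (star x * x) * (star x * x) *
        cfc (fun r : ℝ => (Real.sqrt r)⁻¹) (star x * x) = 1 := by
  -- Invertibility of x keeps 0 out of the spectrum, which makes the inverse square root continuous
  -- there.
  have hpos : ∀ r ∈ spectrum ℝ (star x * x), 0 < r := fun r hr => by
    refine lt_of_le_of_ne (spectrum_star_mul_self_nonneg r hr) ?_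
    rintro rfl
    exact spectrum.zero_notMem_iff ℝ |>.mpr (hx.star.mul hx) hr
  have hc : ContinuousOn (fun r : ℝ => (Real.sqrt r)⁻¹) (spectrum ℝ (star x * x)) :=
    Real.continuous_sqrt.continuousOn.inv₀ fun r hr => (Real.sqrt_pos.mpr (hpos r hr)).ne'
  refine ⟨hc, ?_⟩
  have hsa : IsSelfAdjoint (star x * x) := IsSelfAdjoint.star_mul_self x
  have hid : cfc (fun r : ℝ => r) (star x * x) = star x * x := cfc_id' ℝ _
  calc cfc (fun r : ℝ => (Real.sqrt r)⁻¹) (star x * x) * (star x * x) *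
        cfc (fun r : ℝ => (Real.sqrt r)⁻¹) (star x * x)
      = cfc (fun r : ℝ => (Real.sqrt r)⁻¹) (star x * x) * cfc (fun r : ℝ => r) (star x * x) *
        cfc (fun r : ℝ => (Real.sqrt r)⁻¹) (star x * x) := by rw [hid]
    _ = cfc (fun r : ℝ => (Real.sqrt r)⁻¹ * r * (Real.sqrt r)⁻¹) (star x * x) := by
        rw [← cfc_mul _ _ _ hc (by fun_prop),
          ← cfc_mul (fun r : ℝ => (Real.sqrt r)⁻¹ * r) _ _ (hc.mul (by fun_prop)) hc]
    _ = cfc (fun _ : ℝ => (1 : ℝ)) (star x * x) := by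
        refine cfc_congr fun r hr => ?_
        have h0 := hpos r hr
        have h1 := Real.sqrt_pos.mpr h0
        have h2 := Real.mul_self_sqrt h0.le
        change (Real.sqrt r)⁻¹ * r * (Real.sqrt r)⁻¹ = 1
        nth_rewrite 2 [← h2]
        field_simp
    _ = 1 := by rw [cfc_const_one ℝ (star x * x)]

/-- An invertible eigenvector of a circle action yields an eigenunitary. -/
theorem CircleAction.eigenunitaries_nonempty_of_isUnit {x : A} (hx : IsUnit x)
    (hs : α.IsSpectral 1 x) : α.eigenunitaries.Nonempty := by
  obtain ⟨hcont, hc⟩ := exists_cfc_inv_sqrt hx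
  set c := cfc (fun r : ℝ => (Real.sqrt r)⁻¹) (star x * x) with hcdef
  have hcs : star c = c := (IsSelfAdjoint.cfc : IsSelfAdjoint c)
  have hsa : IsSelfAdjoint (star x * x) := IsSelfAdjoint.star_mul_self x
  -- The element x*x has degree −1 + 1 = 0, and automorphisms commute with the functional calculus.
  have hfix : ∀ ζ : Circle, α ζ c = c := fun ζ => by
    have h1 : α ζ (star x * x) = star x * x := by
      have := hs.star.mul hs ζ
      simpa using this
    have h2 := StarAlgHomClass.map_cfc (S := ℂ) (α ζ) (fun r : ℝ => (Real.sqrt r)⁻¹) (star x * x)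
      hcont (StarAlgEquiv.isometry (α ζ)).continuous hsa (by rw [h1]; exact hsa)
    rw [h1] at h2
    exact h2
  have hcu : IsUnit c := by
    -- The inverse of c is x*x c; it is two-sided because c commutes with x*x.
    refine ⟨⟨c, star x * x * c, by rw [← mul_assoc]; exact hc, ?_⟩, rfl⟩
    have h4 : c * (star x * x) = star x * x * c := by
      have h3 := cfc_commute_cfc (fun r : ℝ => (Real.sqrt r)⁻¹) (fun r : ℝ => r) (star x * x)
      rw [cfc_id' ℝ (star x * x)] at h3
      exact h3
    rw [← h4]
    exact hc
  have h5 : star (x * c) * (x * c) = 1 := by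
    rw [star_mul, hcs, ← hc]
    simp only [mul_assoc]
  refine ⟨x * c, ⟨h5, ?_⟩, fun ζ => ?_⟩
  -- The element xc is an isometry and invertible, so its adjoint is its inverse.
  · obtain ⟨w, hw⟩ := hx.mul hcu
    rw [← hw] at h5 ⊢
    rw [Units.eq_inv_of_mul_eq_one_right h5, Units.mul_inv]
  · rw [map_mul, hfix, hs, zpow_one, smul_mul_assoc]

/-- A circle action with the Rokhlin property has an exact eigenunitary. -/
theorem CircleAction.HasRokhlinProperty.eigenunitaries_nonempty (h : α.HasRokhlinProperty) :
    α.eigenunitaries.Nonempty := by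
  -- Any tolerance below 1 would do. No approximate commutation is needed, so the finite set is
  -- empty.
  obtain ⟨w, hw, hζ, -⟩ := h (1 / 2) (by norm_num) ∅
  have hs := α.isSpectral_average_trigMonomial 1 w
  have hdist : ‖w - α.average (trigMonomial 1 w)‖ < 1 := by
    have e : w - α.average (trigMonomial 1 w) =
        ∫ s : Circle, (w - α s⁻¹ (trigMonomial 1 w s)) ∂circleHaar := by
      rw [integral_sub (integrable_const w) (integrable_circle (by fun_prop)), integral_const,
        probReal_univ, one_smul]
      rfl
    rw [e]
    refine lt_of_le_of_lt (norm_integral_le_of_norm_le_const (C := 1 / 2)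
      (.of_forall fun s => ?_)) (by rw [probReal_univ]; norm_num)
    have e2 : w - α s⁻¹ (trigMonomial 1 w s) =
        -((s : ℂ) • (α s⁻¹ w - ((s⁻¹ : Circle) : ℂ) • w)) := by
      rw [trigMonomial_apply, zpow_one, map_smul, smul_sub, smul_smul, ← Circle.coe_mul,
        mul_inv_cancel, Circle.coe_one, one_smul, neg_sub]
    rw [e2, norm_neg, norm_smul, Circle.norm_coe, one_mul]
    exact (hζ s⁻¹).le
  refine CircleAction.eigenunitaries_nonempty_of_isUnit ?_ hs
  set x := α.average (trigMonomial 1 w)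
  have h1 : ‖star w * (w - x)‖ < 1 := by
    rwa [CStarRing.norm_mem_unitary_mul _ (Unitary.star_mem hw)]
  -- This exhibits x as a unitary times 1 minus an element of norm less than 1, hence as invertible.
  have h2 : w * (1 - star w * (w - x)) = x := by
    rw [mul_sub, mul_sub, mul_one, mul_sub, ← mul_assoc, ← mul_assoc, hw.2, one_mul, one_mul,
      sub_sub_cancel]
  rw [← h2]
  exact IsUnit.mul ⟨⟨w, star w, hw.2, hw.1⟩, rfl⟩ (isUnit_one_sub_of_norm_lt_one h1)

end Rokhlin

/-! ### The embedding of the fixed point algebra -/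

theorem isFixedPointEmbedding_subtype {A : Type*} [CStarAlgebra A] (α : CircleAction A) :
    IsFixedPointEmbedding α (NonUnitalStarSubalgebraClass.subtype α.fixedPoints) where
  norm_map _ := rfl
  isSpectral d := CircleAction.mem_fixedPoints_iff.mp d.2
  exists_eq a ha := ⟨⟨a, CircleAction.mem_fixedPoints_iff.mpr ha⟩, rfl⟩

end CircleRokhlin

end

theorem mainTheorem12 :
    (∀ (A : Type u) [CStarAlgebra A] (α : CircleRokhlin.CircleAction A),
      α.HasRokhlinProperty → α.eigenunitaries.Nonempty) ∧
    ∃ Ψ : ∀ (A : Type u) [CStarAlgebra A] (α : CircleRokhlin.CircleAction A) (u : A),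
        α.HasRokhlinProperty → u ∈ α.eigenunitaries →
          (CircleRokhlin.CrossedProduct α ≃⋆ₐ[ℂ]
            CircleRokhlin.CStarTensor α.fixedPoints
              (CircleRokhlin.compactOperators CircleRokhlin.L2Circle)),
      ∀ (A B : Type u) [CStarAlgebra A] [CStarAlgebra B]
        (α : CircleRokhlin.CircleAction A) (β : CircleRokhlin.CircleAction B) (u : A) (v : B)
        (hα : α.HasRokhlinProperty) (hβ : β.HasRokhlinProperty)
        (hu : u ∈ α.eigenunitaries) (hv : v ∈ β.eigenunitaries)
        (φ : A →⋆ₐ[ℂ] B) (hφ : α.IsEquivariant β φ), φ u = v →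
        ∀ x : CircleRokhlin.CrossedProduct α,
          Ψ B β v hβ hv (CircleRokhlin.CrossedProduct.map φ hφ x) =
            CircleRokhlin.CStarTensor.map
              (CircleRokhlin.compactOperators CircleRokhlin.L2Circle)
              (CircleRokhlin.CircleAction.fixedPointsMap φ hφ) (Ψ A α u hα hu x) := by
  -- The Fourier basis is chosen once for all triples; naturality requires the same matrix units of
  -- 𝒦(L²(𝕋)) on both sides.
  refine ⟨fun A _ α h => h.eigenunitaries_nonempty, fun A _ α u _ hu =>
    CircleRokhlin.stabilization (u := ⟨u, hu.1⟩) CircleRokhlin.circleBasis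
      (CircleRokhlin.isFixedPointEmbedding_subtype α) hu.2, ?_⟩
  intro A B _ _ α β u v hα hβ hu hv φ hφ huv x
  exact CircleRokhlin.stabilization_map CircleRokhlin.circleBasis
    (CircleRokhlin.isFixedPointEmbedding_subtype α)
    (CircleRokhlin.isFixedPointEmbedding_subtype β) hu.2 hv.2 φ hφ huv _ (fun _ => rfl) x
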